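/- Let $\mathbb D$ be the open unit disc, let $L^2=L^2(\partial\mathbb D)$ be taken with respect to normalised Lebesgue measure on the unit circle, and let $H^2\subset L^2$ be the Hardy space, i.e. the functions in $L^2$ whose Fourier coefficients with negative indices vanish, identified with the analytic functions on $\mathbb D$ with square summable Maclaurin coefficients. An inner function is a bounded analytic function $\alpha$ on $\mathbb D$ whose boundary values satisfy $|\alpha|=1$ almost everywhere on $\partial\mathbb D$. For inner $\alpha$ let $K_\alpha=H^2\ominus\alpha H^2$ be the model space, $$k_w^\alpha(z)=\frac{1-\overline{\alpha(w)}\,\alpha(z)}{1-\overline w z}\qquad(w,z\in\mathbb D)$$ its reproducing kernel, and $P_\alpha$ the orthogonal projection of $L^2$ onto $K_\alpha$, extended to $f\in L^1(\partial\mathbb D)$ by $P_\alpha f(z)=\frac1{2\pi}\int_0^{2\pi} f(e^{it})\,\overline{k_z^\alpha(e^{it})}\,dt$, $z\in\mathbb D$. For inner functions $\alpha,\beta$ and $\varphi\in L^2$, the asymmetric truncated Toeplitz operator $A_\varphi^{\alpha,\beta}$ is the (possibly unbounded) densely defined operator from $K_\alpha$ into $K_\beta$ given by $A_\varphi^{\alpha,\beta}f=P_\beta(\varphi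 f)$ for all $f\in K_\alpha$ such that $P_\beta(\varphi f)\in K_\beta$; its domain contains all bounded functions in $K_\alpha$. Let $\alpha,\beta$ be two nonconstant inner functions and let $\varphi\in L^2(\partial\mathbb D)$. Then there are $\chi\in K_\alpha$ and $\psi\in K_\beta$ such that $$A_\varphi^{\alpha,\beta}=A_{\overline\chi+\psi}^{\alpha,\beta}.$$ Moreover, if $\chi\in K_\alpha$, $\psi\in K_\beta$ is one such pair, then the pairs $(\chi_1,\psi_1)\in K_\alpha\times K_\beta$ with $A_\varphi^{\alpha,\beta}=A_{\overline{\chi_1}+\psi_1}^{\alpha,\beta}$ are exactly the pairs $$\chi_1=\chi-\overline c\,k_0^\alpha,\qquad \psi_1=\psi+c\,k_0^\beta,\qquad c\in\mathbb C.$$ -/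

import Mathlib

open MeasureTheory Filter Topology AddCircle
open scoped ComplexConjugate Complex.UnitDisc ENNReal

noncomputable section

namespace ModelSpaces

/-- The space `L²(∂𝔻)`. The unit circle is parametrised by `t ↦ e^{2πit} = fourier 1 t`, with `t` in
`ℝ/ℤ`, and carries the normalised Lebesgue measure. -/
abbrev L2 : Type := Lp ℂ 2 (haarAddCircle : Measure UnitAddCircle)

/-- The Hardy space `H²`, as the subspace of those functions in `L²(∂𝔻)` whose Fourier coefficients
with negative indices vanish. -/
def H2 : Submodule ℂ L2 where
  carrier := {f | ∀ n : ℤ, n < 0 → fourierCoeff f n = 0}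
  zero_mem' := by
    intro n _
    rw [← fourierBasis_repr, map_zero]
    rfl
  add_mem' := by
    intro f g hf hg n hn
    have hf' := hf n hn
    have hg' := hg n hn
    rw [← fourierBasis_repr] at hf' hg' ⊢
    rw [map_add, lp.coeFn_add, Pi.add_apply, hf', hg', add_zero]
  smul_mem' := by
    intro c f hf n hn
    have hf' := hf n hn
    rw [← fourierBasis_repr] at hf' ⊢
    rw [map_smul, lp.coeFn_smul, Pi.smul_apply, hf', smul_zero]

/-- The analytic function on `𝔻` that is identified with `f ∈ H²`:
`f(z) = ∑ aₙ zⁿ`, where the `aₙ` are the Fourier coefficients of the boundary function. -/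
def diskValue (f : L2) (z : 𝔻) : ℂ := ∑' n : ℕ, fourierCoeff f (n : ℤ) * (z : ℂ) ^ n

/-- The radial boundary function `t ↦ lim_{r → 1⁻} F(r e^{2πit})` of a function on the disc. -/
def boundaryValue (F : ℂ → ℂ) (t : UnitAddCircle) : ℂ :=
  limUnder (𝓝[<] (1 : ℝ)) fun r : ℝ => F (r * fourier 1 t)

/-- Inner functions: bounded analytic functions on `𝔻` whose boundary values have modulus one
almost everywhere. Only the values of `toFun` on the open unit disc matter. -/
structure InnerFunction where
  toFun : ℂ → ℂ
  analytic : DifferentiableOn ℂ toFun (Metric.ball 0 1)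
  bounded : ∃ C : ℝ, ∀ z ∈ Metric.ball (0 : ℂ) 1, ‖toFun z‖ ≤ C
  unimodular : ∀ᵐ t ∂(haarAddCircle : Measure UnitAddCircle), ∃ ζ : ℂ,
    Tendsto (fun r : ℝ => toFun (r * fourier 1 t)) (𝓝[<] (1 : ℝ)) (𝓝 ζ) ∧ ‖ζ‖ = 1

namespace InnerFunction

variable (α : InnerFunction)

/-- `α` is a constant function on `𝔻`. -/
def IsConstant : Prop := ∃ c : ℂ, ∀ z : 𝔻, α.toFun z = c

/-- The boundary function of `α`. -/
def bdry : UnitAddCircle → ℂ := boundaryValue α.toFun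

theorem norm_bdry : ∀ᵐ t ∂(haarAddCircle : Measure UnitAddCircle), ‖α.bdry t‖ = 1 := by
  filter_upwards [α.unimodular] with t ⟨ζ, hζ, h1⟩
  rw [bdry, boundaryValue, hζ.limUnder_eq, h1]

theorem aestronglyMeasurable_bdry :
    AEStronglyMeasurable α.bdry (haarAddCircle : Measure UnitAddCircle) := by
  have hpos : ∀ n : ℕ, (0 : ℝ) < 1 / ((n : ℝ) + 2) ∧ 1 / ((n : ℝ) + 2) < 1 := by
    intro n
    have hn : (0 : ℝ) ≤ n := n.cast_nonneg
    refine ⟨by positivity, ?_⟩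
    rw [div_lt_one (by positivity)]
    linarith
  have hr : Tendsto (fun n : ℕ => 1 - 1 / ((n : ℝ) + 2)) atTop (𝓝[<] (1 : ℝ)) := by
    refine tendsto_nhdsWithin_iff.mpr ⟨?_, Eventually.of_forall fun n => ?_⟩
    · have h : Tendsto (fun n : ℕ => 1 / ((n : ℝ) + 2)) atTop (𝓝 0) := by
        simp_rw [one_div]
        exact (tendsto_atTop_add_const_right _ 2 tendsto_natCast_atTop_atTop).inv_tendsto_atTop
      simpa using h.const_sub 1
    · have := (hpos n).1
      simp only [Set.mem_Iio]
      linarith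
  refine aestronglyMeasurable_of_tendsto_ae atTop
    (f := fun (n : ℕ) t => α.toFun (((1 - 1 / ((n : ℝ) + 2) : ℝ) : ℂ) * fourier 1 t))
    (fun n => ?_) ?_
  · refine Continuous.aestronglyMeasurable ?_
    refine α.analytic.continuousOn.comp_continuous
      (continuous_const.mul (map_continuous (fourier 1))) fun t => ?_
    have h1 := hpos n
    rw [mem_ball_zero_iff, norm_mul, fourier_apply, Circle.norm_coe, mul_one, Complex.norm_real,
      Real.norm_eq_abs, abs_of_pos (by linarith)]
    linarith
  · filter_upwards [α.unimodular] with t ⟨ζ, hζ, _⟩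
    rw [bdry, boundaryValue, hζ.limUnder_eq]
    exact hζ.comp hr

/-- The subspace `αH²` of `L²(∂𝔻)`. -/
def mulH2 : Submodule ℂ L2 where
  carrier := {f | ∃ h ∈ H2, f =ᵐ[haarAddCircle] fun t => α.bdry t * h t}
  zero_mem' := by
    refine ⟨0, H2.zero_mem, ?_⟩
    filter_upwards with t
    simp
  add_mem' := by
    rintro f g ⟨h, hh, hf⟩ ⟨k, hk, hg⟩
    refine ⟨h + k, H2.add_mem hh hk, ?_⟩
    filter_upwards [hf, hg, Lp.coeFn_add f g, Lp.coeFn_add h k] with t h1 h2 h3 h4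
    rw [h3, h4, Pi.add_apply, Pi.add_apply, h1, h2, mul_add]
  smul_mem' := by
    rintro c f ⟨h, hh, hf⟩
    refine ⟨c • h, H2.smul_mem c hh, ?_⟩
    filter_upwards [hf, Lp.coeFn_smul c f, Lp.coeFn_smul c h] with t h1 h2 h3
    rw [h2, h3, Pi.smul_apply, Pi.smul_apply, h1, smul_eq_mul, smul_eq_mul, mul_left_comm]

/-- The model space `K_α = H² ⊖ αH²`. -/
def K : Submodule ℂ L2 := H2 ⊓ α.mulH2ᗮ

/-- The boundary function of the reproducing kernel
`k_w^α(z) = (1 - conj (α(w)) α(z)) / (1 - conj w z)`. -/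
def kernelFun (w : 𝔻) (t : UnitAddCircle) : ℂ :=
  (1 - conj (α.toFun w) * α.bdry t) / (1 - conj (w : ℂ) * fourier 1 t)

theorem aestronglyMeasurable_kernelFun (w : 𝔻) :
    AEStronglyMeasurable (α.kernelFun w) (haarAddCircle : Measure UnitAddCircle) := by
  have h1 : AEStronglyMeasurable (fun t => 1 - conj (α.toFun w) * α.bdry t)
      (haarAddCircle : Measure UnitAddCircle) :=
    aestronglyMeasurable_const.sub (α.aestronglyMeasurable_bdry.const_mul _)
  have h2 : AEStronglyMeasurable (fun t => 1 - conj (w : ℂ) * fourier 1 t)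
      (haarAddCircle : Measure UnitAddCircle) :=
    (continuous_const.sub
      (continuous_const.mul (map_continuous (fourier 1)))).aestronglyMeasurable
  exact (h1.aemeasurable.div h2.aemeasurable).aestronglyMeasurable

theorem norm_kernelFun_le (w : 𝔻) : ∀ᵐ t ∂(haarAddCircle : Measure UnitAddCircle),
    ‖α.kernelFun w t‖ ≤ (1 + ‖α.toFun w‖) / (1 - ‖(w : ℂ)‖) := by
  filter_upwards [α.norm_bdry] with t ht
  have hw : ‖(w : ℂ)‖ < 1 := w.norm_lt_one
  rw [kernelFun, norm_div]
  refine div_le_div₀ (by positivity) ?_ (by linarith) ?_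
  · refine (norm_sub_le _ _).trans ?_
    rw [norm_mul, ht, RCLike.norm_conj, norm_one, mul_one]
  · refine le_trans ?_ (norm_sub_norm_le _ _)
    rw [norm_mul, fourier_apply, Circle.norm_coe, RCLike.norm_conj, norm_one, mul_one]

theorem memLp_kernelFun (w : 𝔻) :
    MemLp (α.kernelFun w) 2 (haarAddCircle : Measure UnitAddCircle) :=
  MemLp.of_bound (α.aestronglyMeasurable_kernelFun w) _ (α.norm_kernelFun_le w)

/-- The kernel `k_w^α` as an element of `L²(∂𝔻)`. -/
def kernel (w : 𝔻) : L2 := (α.memLp_kernelFun w).toLp (α.kernelFun w)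

/-- The projection `P_α`, extended to `g ∈ L¹(∂𝔻)`: `P_α g` is the function
`z ↦ ⟨g, k_z^α⟩` on `𝔻`. -/
def proj (g : UnitAddCircle → ℂ) (z : 𝔻) : ℂ :=
  ∫ t, g t * conj (α.kernelFun z t) ∂haarAddCircle

theorem integrable_proj (φ f : L2) (z : 𝔻) :
    Integrable (fun t => φ t * f t * conj (α.kernelFun z t))
      (haarAddCircle : Measure UnitAddCircle) := by
  have h1 : Integrable (fun t => φ t * f t) (haarAddCircle : Measure UnitAddCircle) :=
    (Lp.memLp φ).integrable_mul (Lp.memLp f)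
  refine h1.mul_bdd (c := (1 + ‖α.toFun z‖) / (1 - ‖(z : ℂ)‖)) ?_ ?_
  · exact Complex.continuous_conj.comp_aestronglyMeasurable (α.aestronglyMeasurable_kernelFun z)
  · filter_upwards [α.norm_kernelFun_le z] with t ht
    rwa [RCLike.norm_conj]

end InnerFunction

theorem summable_diskValue (f : L2) (z : 𝔻) :
    Summable fun n : ℕ => fourierCoeff f (n : ℤ) * (z : ℂ) ^ n := by
  have hb : ∀ n : ℤ, ‖fourierCoeff f n‖ ≤ ‖f‖ := by
    intro n
    rw [← fourierBasis_repr, ← fourierBasis.repr.norm_map f]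
    exact lp.norm_apply_le_norm (by norm_num) _ n
  refine Summable.of_norm_bounded (g := fun n : ℕ => ‖f‖ * ‖(z : ℂ)‖ ^ n)
    ((summable_geometric_of_lt_one (norm_nonneg _) z.norm_lt_one).mul_left _) fun n => ?_
  rw [norm_mul, norm_pow]
  exact mul_le_mul_of_nonneg_right (hb n) (by positivity)

theorem diskValue_add (f g : L2) (z : 𝔻) :
    diskValue (f + g) z = diskValue f z + diskValue g z := by
  rw [diskValue, diskValue, diskValue,
    ← (summable_diskValue f z).tsum_add (summable_diskValue g z)]
  refine tsum_congr fun n => ?_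
  rw [← fourierBasis_repr, ← fourierBasis_repr, ← fourierBasis_repr, map_add, lp.coeFn_add,
    Pi.add_apply, add_mul]

theorem diskValue_smul (c : ℂ) (f : L2) (z : 𝔻) : diskValue (c • f) z = c * diskValue f z := by
  rw [diskValue, diskValue, ← tsum_mul_left]
  refine tsum_congr fun n => ?_
  rw [← fourierBasis_repr, ← fourierBasis_repr, map_smul, lp.coeFn_smul, Pi.smul_apply,
    smul_eq_mul, mul_assoc]

/-- A function in `H²` is determined by its values in the disc. -/
theorem eq_zero_of_diskValue_eq_zero {f : L2} (hf : f ∈ H2) (h : ∀ z : 𝔻, diskValue f z = 0) :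
    f = 0 := by
  have hc : ∀ n : ℕ, fourierCoeff f (n : ℤ) = 0 := by
    set p : FormalMultilinearSeries ℂ ℂ ℂ :=
      FormalMultilinearSeries.ofScalars ℂ (fun n : ℕ => fourierCoeff f (n : ℤ)) with hp
    have hasum : ∀ y : ℂ, ‖y‖ < 1 → HasSum (fun n => p n fun _ => y) 0 := by
      intro y hy
      have h0 := (summable_diskValue f (Complex.UnitDisc.mk y hy)).hasSum
      have h1 := h (Complex.UnitDisc.mk y hy)
      rw [diskValue] at h1
      rw [h1] at h0
      simpa [hp, FormalMultilinearSeries.ofScalars, mul_comm] using h0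
    have hps : HasFPowerSeriesAt (fun _ : ℂ => (0 : ℂ)) p 0 := by
      refine ⟨1, ?_, one_pos, ?_⟩
      · refine ENNReal.le_of_forall_nnreal_lt fun r hr => ?_
        have hr' : (r : ℝ) < 1 := by exact_mod_cast hr
        refine p.le_radius_of_tendsto (l := 0) ?_
        have h2 := (summable_diskValue f
          (Complex.UnitDisc.mk (r : ℂ) (by simpa using hr'))).tendsto_atTop_zero.norm
        simpa [hp, FormalMultilinearSeries.ofScalars_norm] using h2
      · intro y hy
        have hy' : ‖y‖ < 1 := by simpa [← ofReal_norm] using hy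
        exact hasum y hy'
    have hp0 : p = 0 := hps.eq_zero
    intro n
    have h3 : p.coeff n = 0 := by rw [hp0]; rfl
    simpa [hp] using h3
  have h0 : fourierBasis.repr f = 0 := by
    ext n
    rw [fourierBasis_repr]
    rcases lt_or_ge n 0 with hn | hn
    · exact hf n hn
    · lift n to ℕ using hn
      exact hc n
  exact (LinearIsometryEquiv.map_eq_zero_iff _).mp h0

/-- The graph of the asymmetric truncated Toeplitz operator: the pairs `(f, g)` in `K_α × K_β` with
`g = P_β (φ f)` on `𝔻`. -/
def attoGraph (α β : InnerFunction) (φ : L2) : Submodule ℂ (α.K × β.K) where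
  carrier := {x | ∀ z : 𝔻,
    diskValue (x.2 : L2) z = β.proj (fun t => φ t * (x.1 : L2) t) z}
  zero_mem' := by
    intro z
    have h1 : diskValue (0 : L2) z = 0 := by
      simpa using diskValue_smul 0 (0 : L2) z
    have h2 : β.proj (fun t => φ t * (0 : L2) t) z = 0 := by
      refine integral_eq_zero_of_ae ?_
      filter_upwards with t
      simp
    exact h1.trans h2.symm
  add_mem' := by
    rintro ⟨f, g⟩ ⟨f', g'⟩ h h' z
    change diskValue ((g : L2) + g') z = β.proj (fun t => φ t * ((f : L2) + f' : L2) t) z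
    rw [diskValue_add, h z, h' z, InnerFunction.proj, InnerFunction.proj,
      ← integral_add (β.integrable_proj φ f z) (β.integrable_proj φ f' z)]
    refine integral_congr_ae ?_
    filter_upwards [Lp.coeFn_add (f : L2) f'] with t ht
    rw [ht, Pi.add_apply]
    ring
  smul_mem' := by
    rintro c ⟨f, g⟩ h z
    change diskValue (c • (g : L2)) z = β.proj (fun t => φ t * (c • (f : L2) : L2) t) z
    rw [diskValue_smul, h z, InnerFunction.proj, ← integral_const_mul]
    refine integral_congr_ae ?_
    filter_upwards [Lp.coeFn_smul c (f : L2)] with t ht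
    rw [ht, Pi.smul_apply, smul_eq_mul]
    ring

/-- The asymmetric truncated Toeplitz operator `A_φ^{α,β} f = P_β (φ f)` from `K_α` into `K_β`, on
its maximal domain, which consists of all `f ∈ K_α` for which `P_β (φ f)` belongs to `K_β`. The
domain contains every bounded function in `K_α`. -/
def atto (α β : InnerFunction) (φ : L2) : α.K →ₗ.[ℂ] β.K :=
  (attoGraph α β φ).toLinearPMap

theorem atto_graph (α β : InnerFunction) (φ : L2) : (atto α β φ).graph = attoGraph α β φ := by
  refine Submodule.toLinearPMap_graph_eq _ ?_
  rintro ⟨f, g⟩ h hf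
  simp only at hf
  subst hf
  refine Subtype.ext (eq_zero_of_diskValue_eq_zero g.2.1 fun z => ?_)
  refine (h z).trans (integral_eq_zero_of_ae ?_)
  filter_upwards with t
  simp

end ModelSpaces

end

noncomputable section

namespace ModelSpaces

-- Existence. Split `φ = g + e` with `g ∈ H²` and `e ⊥ H²`, so that `ē ∈ H²`. Since `H² = K_α ⊕
-- αH²`, and likewise for `β`, write `g = ψ + βq` and `ē = χ + αp`. The symbols `conj (αp)` and `βq`
-- contribute nothing (`atto_eq_of_ae_eq_add`): the first because `K_α ⊥ αH²`, the second because `β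
-- · conj k_z^β = (β - β(z)) / (1 - z ζ̄)` lies in `H^∞` and vanishes at the origin. This holds for
-- every `f ∈ K_α`, so the domains agree too. The stated family of pairs is another instance, as
-- `k_0^α = 1 - conj (α(0)) α`.
--
-- Uniqueness. Let `D = χ̄ + ψ` be the difference of two symbols of one operator. Testing on kernels
-- gives `∫ D k_w^α conj k_z^β = 0`. Multiplying by `1 - w̄z` splits the product of Cauchy kernels
-- (`kernelFun_mul_conj_kernelFun`), and the equations become `ψ(z) + conj χ(w) = β(z) B(w) + conj
-- α(w) Q(z) + C` (`exists_separated`). As `α` and `β` are nonconstant, `ψ` is affine in `β` and `χ`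
-- is affine in `α` (`exists_eq_add_mul`), hence both are multiples of the kernels at the origin
-- (`IsModel.ae_eq_kernelFun`). Such a symbol acts as a scalar times the compression of the
-- identity, and `exists_integral_mul_conj_ne_zero` shows that this compression is not zero, so the
-- scalar is.

local notation "μ₀" => (haarAddCircle : Measure UnitAddCircle)

/-! ### Hardy functions on the circle -/

/-- Functions on the circle that represent an element of `H²`. -/
structure IsHardy (f : UnitAddCircle → ℂ) : Prop where
  memLp : MemLp f 2 μ₀
  integral_eq_zero : ∀ n : ℕ, n ≠ 0 → ∫ t, fourier n t * f t ∂μ₀ = 0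

/-- Functions on the circle that represent an element of `H^∞`. -/
structure IsBddHardy (f : UnitAddCircle → ℂ) : Prop where
  aestronglyMeasurable : AEStronglyMeasurable f μ₀
  bounded : ∃ C : ℝ, ∀ᵐ t ∂μ₀, ‖f t‖ ≤ C
  integral_eq_zero : ∀ n : ℕ, n ≠ 0 → ∫ t, fourier n t * f t ∂μ₀ = 0

/-- `f` is integrable with integral `c`. -/
def HasIntegralEq (f : UnitAddCircle → ℂ) (c : ℂ) : Prop :=
  Integrable f μ₀ ∧ ∫ t, f t ∂μ₀ = c

namespace HasIntegralEq

variable {f g : UnitAddCircle → ℂ} {a b : ℂ}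

theorem add (hf : HasIntegralEq f a) (hg : HasIntegralEq g b) :
    HasIntegralEq (fun t => f t + g t) (a + b) :=
  ⟨hf.1.add hg.1, by rw [integral_add hf.1 hg.1, hf.2, hg.2]⟩

theorem const_mul (c : ℂ) (hf : HasIntegralEq f a) :
    HasIntegralEq (fun t => c * f t) (c * a) :=
  ⟨hf.1.const_mul c, by rw [integral_const_mul, hf.2]⟩

theorem congr (hf : HasIntegralEq f a) (h : g =ᵐ[μ₀] f) : HasIntegralEq g a :=
  ⟨hf.1.congr h.symm, by rw [integral_congr_ae h, hf.2]⟩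

theorem conj_eq (hf : HasIntegralEq f a) : HasIntegralEq (fun t => conj (f t)) (conj a) :=
  ⟨(RCLike.conjCLE (K := ℂ)).toContinuousLinearMap.integrable_comp hf.1, by
    rw [integral_conj, hf.2]⟩

end HasIntegralEq

theorem norm_fourier_apply (n : ℤ) (t : UnitAddCircle) : ‖fourier n t‖ = 1 := by
  rw [fourier_apply, Circle.norm_coe]

theorem integrable_mul_of_memLp {f g : UnitAddCircle → ℂ} (hf : MemLp f 2 μ₀)
    (hg : MemLp g 2 μ₀) : Integrable (fun t => f t * g t) μ₀ :=
  hf.integrable_mul hg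

theorem memLp_bdd_mul {f g : UnitAddCircle → ℂ} (hf : AEStronglyMeasurable f μ₀)
    (hb : ∃ C : ℝ, ∀ᵐ t ∂μ₀, ‖f t‖ ≤ C) (hg : MemLp g 2 μ₀) :
    MemLp (fun t => f t * g t) 2 μ₀ := by
  obtain ⟨C, hC⟩ := hb
  refine hg.of_le_mul (c := C) (hf.mul hg.1) ?_
  filter_upwards [hC] with t ht
  rw [norm_mul]
  gcongr

theorem memLp_conj {f : UnitAddCircle → ℂ} (hf : MemLp f 2 μ₀) :
    MemLp (fun t => conj (f t)) 2 μ₀ :=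
  hf.star

theorem memLp_fourier_mul {f : UnitAddCircle → ℂ} (hf : MemLp f 2 μ₀) (n : ℤ) :
    MemLp (fun t => fourier n t * f t) 2 μ₀ :=
  memLp_bdd_mul (map_continuous (fourier n)).aestronglyMeasurable
    ⟨1, ae_of_all _ fun t => (norm_fourier_apply n t).le⟩ hf

theorem mem_H2_iff (f : L2) : f ∈ H2 ↔ IsHardy f := by
  constructor
  · intro h
    refine ⟨Lp.memLp f, fun n hn => ?_⟩
    have := h (-n) (by omega)
    simpa [fourierCoeff] using this
  · intro h n hn
    have := h.2 (-n).toNat (by omega)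
    rw [Int.toNat_of_nonneg (by omega)] at this
    simpa [fourierCoeff] using this

namespace IsHardy

variable {f g : UnitAddCircle → ℂ}

theorem congr (hf : IsHardy f) (h : g =ᵐ[μ₀] f) : IsHardy g := by
  refine ⟨hf.1.ae_eq h.symm, fun n hn => ?_⟩
  rw [← hf.2 n hn]
  refine integral_congr_ae ?_
  filter_upwards [h] with t ht
  rw [ht]

theorem toLp_mem (hf : IsHardy f) : hf.memLp.toLp f ∈ H2 :=
  (mem_H2_iff _).2 (hf.congr hf.memLp.coeFn_toLp)

theorem fourier_mul (hf : IsHardy f) (n : ℕ) : IsHardy fun t => fourier n t * f t := by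
  refine ⟨memLp_fourier_mul hf.1 n, fun k hk => ?_⟩
  rw [← hf.2 (k + n) (by omega)]
  refine integral_congr_ae (ae_of_all _ fun t => ?_)
  simp only [Nat.cast_add, fourier_add, mul_assoc]

/-- Evaluation at the origin is multiplicative. -/
theorem integral_mul (hf : IsHardy f) (hg : IsHardy g) :
    ∫ t, f t * g t ∂μ₀ = (∫ t, f t ∂μ₀) * ∫ t, g t ∂μ₀ := by
  have hf' := memLp_conj hf.1
  set F : L2 := hf'.toLp _
  set G : L2 := hg.1.toLp _
  have hG : ∀ n : ℤ, inner ℂ (fourierBasis n) G = ∫ t, fourier (-n) t * g t ∂μ₀ := by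
    intro n
    rw [← HilbertBasis.repr_apply_apply, fourierBasis_repr, fourierCoeff]
    refine integral_congr_ae ?_
    filter_upwards [hg.1.coeFn_toLp] with t ht
    simp only [G, ht, smul_eq_mul]
  have hF : ∀ n : ℤ, inner ℂ F (fourierBasis n) = ∫ t, fourier n t * f t ∂μ₀ := by
    intro n
    rw [← inner_conj_symm, ← HilbertBasis.repr_apply_apply, fourierBasis_repr, fourierCoeff,
      ← integral_conj]
    refine integral_congr_ae ?_
    filter_upwards [hf'.coeFn_toLp] with t ht
    simp only [F, ht, smul_eq_mul, map_mul, fourier_neg, Complex.conj_conj]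
  have hFG : inner ℂ F G = ∫ t, f t * g t ∂μ₀ := by
    rw [L2.inner_def]
    refine integral_congr_ae ?_
    filter_upwards [hf'.coeFn_toLp, hg.1.coeFn_toLp] with t h1 h2
    simp only [F, G, h1, h2, RCLike.inner_apply, Complex.conj_conj, mul_comm]
  -- Parseval for `conj f` and `g`: one has frequencies `≤ 0`, the other `≥ 0`, so only the term at
  -- `0` survives.
  rw [← hFG, ← fourierBasis.tsum_inner_mul_inner F G, tsum_eq_single 0, hF, hG]
  · simp
  · intro n hn
    rw [hF, hG]
    rcases lt_or_gt_of_ne hn with h | h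
    · have := hg.2 (-n).toNat (by omega)
      rw [Int.toNat_of_nonneg (by omega)] at this
      rw [this, mul_zero]
    · have := hf.2 n.toNat (by omega)
      rw [Int.toNat_of_nonneg (by omega)] at this
      rw [this, zero_mul]

theorem integrable (hf : IsHardy f) : Integrable f μ₀ :=
  hf.1.integrable (by norm_num)

theorem add (hf : IsHardy f) (hg : IsHardy g) : IsHardy fun t => f t + g t := by
  refine ⟨hf.1.add hg.1, fun n hn => ?_⟩
  simp only [mul_add]
  rw [integral_add (hf.fourier_mul n).integrable (hg.fourier_mul n).integrable, hf.2 n hn,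
    hg.2 n hn, add_zero]

theorem const_mul (hf : IsHardy f) (c : ℂ) : IsHardy fun t => c * f t := by
  refine ⟨hf.1.const_mul c, fun n hn => ?_⟩
  simp only [mul_left_comm _ c]
  rw [integral_const_mul, hf.2 n hn, mul_zero]

end IsHardy

namespace IsBddHardy

variable {f g : UnitAddCircle → ℂ}

theorem isHardy (hf : IsBddHardy f) : IsHardy f := by
  refine ⟨?_, hf.3⟩
  obtain ⟨C, hC⟩ := hf.2
  exact MemLp.of_bound hf.1 C hC

theorem of_isHardy (hf : IsHardy f) (hb : ∃ C : ℝ, ∀ᵐ t ∂μ₀, ‖f t‖ ≤ C) : IsBddHardy f :=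
  ⟨hf.1.1, hb, hf.2⟩

/-- For `n ≠ 0` the function `ζⁿ f` vanishes at the origin, so by multiplicativity of evaluation
there so does `ζⁿ f g`. -/
theorem mul_isHardy (hf : IsBddHardy f) (hg : IsHardy g) : IsHardy fun t => f t * g t := by
  refine ⟨memLp_bdd_mul hf.1 hf.2 hg.1, fun n hn => ?_⟩
  have := (hf.isHardy.fourier_mul n).integral_mul hg
  rw [hf.3 n hn, zero_mul] at this
  rw [← this]
  simp only [mul_assoc]

theorem add (hf : IsBddHardy f) (hg : IsBddHardy g) : IsBddHardy fun t => f t + g t := by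
  obtain ⟨C, hC⟩ := hf.2
  obtain ⟨D, hD⟩ := hg.2
  refine of_isHardy (hf.isHardy.add hg.isHardy) ⟨C + D, ?_⟩
  filter_upwards [hC, hD] with t h1 h2
  exact norm_add_le_of_le h1 h2

theorem const_mul (hf : IsBddHardy f) (c : ℂ) : IsBddHardy fun t => c * f t := by
  obtain ⟨C, hC⟩ := hf.2
  refine of_isHardy (hf.isHardy.const_mul c) ⟨‖c‖ * C, ?_⟩
  filter_upwards [hC] with t h1
  rw [norm_mul]
  gcongr

theorem mul (hf : IsBddHardy f) (hg : IsBddHardy g) : IsBddHardy fun t => f t * g t := by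
  obtain ⟨C, hC⟩ := hf.2
  obtain ⟨D, hD⟩ := hg.2
  refine of_isHardy (hf.mul_isHardy hg.isHardy) ⟨C * D, ?_⟩
  filter_upwards [hC, hD] with t h1 h2
  rw [norm_mul]
  exact mul_le_mul h1 h2 (norm_nonneg _) ((norm_nonneg _).trans h1)

end IsBddHardy

/-! ### Cauchy kernels and evaluation at points of the disc -/

theorem integral_fourier (n : ℤ) : ∫ t, fourier n t ∂μ₀ = if n = 0 then 1 else 0 := by
  have h := congrFun (fourierCoeff_fourier (T := 1) n) 0
  simp only [fourierCoeff, neg_zero, fourier_zero, one_smul] at h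
  rw [h, Pi.single_apply]
  simp only [eq_comm]

theorem isBddHardy_const (c : ℂ) : IsBddHardy fun _ => c := by
  refine ⟨aestronglyMeasurable_const, ⟨‖c‖, ae_of_all _ fun _ => le_rfl⟩, fun n hn => ?_⟩
  rw [integral_mul_const, integral_fourier, if_neg (by exact_mod_cast hn), zero_mul]

theorem integral_const_haar (c : ℂ) : ∫ _, c ∂μ₀ = c := by
  simp

/-- The boundary function of the Cauchy kernel: `1 / (1 - z ζ̄)`. -/
def cauchyKernel (z : 𝔻) (t : UnitAddCircle) : ℂ := (1 - z * fourier (-1) t)⁻¹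

theorem one_sub_mul_fourier_ne_zero (z : 𝔻) (n : ℤ) (t : UnitAddCircle) :
    1 - (z : ℂ) * fourier n t ≠ 0 := by
  intro h
  have h1 : ‖(z : ℂ) * fourier n t‖ = 1 := by
    rw [← sub_eq_zero.1 h, norm_one]
  rw [norm_mul, norm_fourier_apply, mul_one] at h1
  exact absurd h1 z.norm_lt_one.ne

theorem continuous_cauchyKernel (z : 𝔻) : Continuous (cauchyKernel z) :=
  (continuous_const.sub (continuous_const.mul (map_continuous (fourier (-1))))).inv₀
    fun t => one_sub_mul_fourier_ne_zero z (-1) t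

theorem conj_cauchyKernel (z : 𝔻) (t : UnitAddCircle) :
    conj (cauchyKernel z t) = (1 - conj (z : ℂ) * fourier 1 t)⁻¹ := by
  rw [cauchyKernel, map_inv₀, map_sub, map_mul, map_one, fourier_neg, Complex.conj_conj]

theorem norm_cauchyKernel_le (z : 𝔻) (t : UnitAddCircle) :
    ‖cauchyKernel z t‖ ≤ (1 - ‖(z : ℂ)‖)⁻¹ := by
  have hz : ‖(z : ℂ)‖ < 1 := z.norm_lt_one
  rw [cauchyKernel, norm_inv]
  refine inv_anti₀ (by linarith) (le_trans ?_ (norm_sub_norm_le _ _))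
  rw [norm_mul, norm_fourier_apply, norm_one, mul_one]

theorem hasSum_cauchyKernel (z : 𝔻) (t : UnitAddCircle) :
    HasSum (fun n : ℕ => (z : ℂ) ^ n * fourier (-n) t) (cauchyKernel z t) := by
  have h : ‖(z : ℂ) * fourier (-1) t‖ < 1 := by
    rw [norm_mul, norm_fourier_apply, mul_one]
    exact z.norm_lt_one
  have h1 : ∀ n : ℕ, ((z : ℂ) * fourier (-1) t) ^ n = (z : ℂ) ^ n * fourier (-n) t := by
    intro n
    rw [mul_pow]
    congr 1
    induction n with
    | zero => simp
    | succ n ih => rw [pow_succ, ih, ← fourier_add, Nat.cast_succ, neg_add]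
  have h2 := hasSum_geometric_of_norm_lt_one h
  simp only [h1] at h2
  exact h2

theorem memLp_mul_cauchyKernel {f : UnitAddCircle → ℂ} (hf : MemLp f 2 μ₀) (z : 𝔻) :
    MemLp (fun t => f t * cauchyKernel z t) 2 μ₀ := by
  simp only [mul_comm (f _)]
  exact memLp_bdd_mul (continuous_cauchyKernel z).aestronglyMeasurable
    ⟨_, ae_of_all _ (norm_cauchyKernel_le z)⟩ hf

/-- The Cauchy integral of `f` is the sum of the analytic part of its Fourier series. -/
theorem integral_mul_cauchyKernel {f : UnitAddCircle → ℂ} (hf : Integrable f μ₀) (z : 𝔻) :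
    ∫ t, f t * cauchyKernel z t ∂μ₀ = ∑' n : ℕ, fourierCoeff f (n : ℤ) * (z : ℂ) ^ n := by
  have hz : ‖(z : ℂ)‖ < 1 := z.norm_lt_one
  have key : HasSum (fun n : ℕ => ∫ t, f t * ((z : ℂ) ^ n * fourier (-n) t) ∂μ₀)
      (∫ t, f t * cauchyKernel z t ∂μ₀) := by
    refine hasSum_integral_of_dominated_convergence (fun n t => ‖f t‖ * ‖(z : ℂ)‖ ^ n)
      (fun n => ?_) (fun n => ae_of_all _ fun t => ?_) (ae_of_all _ fun t => ?_) ?_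
      (ae_of_all _ fun t => (hasSum_cauchyKernel z t).mul_left _)
    · exact hf.1.mul ((continuous_const.mul (map_continuous (fourier _))).aestronglyMeasurable)
    · rw [norm_mul, norm_mul, norm_fourier_apply, mul_one, norm_pow]
    · exact (summable_geometric_of_lt_one (norm_nonneg _) hz).mul_left _
    · simp only [tsum_mul_left]
      exact hf.norm.mul_const _
  rw [← key.tsum_eq]
  refine tsum_congr fun n => ?_
  rw [fourierCoeff, ← integral_mul_const]
  refine integral_congr_ae (ae_of_all _ fun t => ?_)
  simp only [smul_eq_mul]
  ring

theorem diskValue_eq_integral (f : L2) (z : 𝔻) :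
    diskValue f z = ∫ t, f t * cauchyKernel z t ∂μ₀ :=
  (integral_mul_cauchyKernel ((Lp.memLp f).integrable (by norm_num)) z).symm

theorem integral_cauchyKernel (z : 𝔻) : ∫ t, cauchyKernel z t ∂μ₀ = 1 := by
  have h := integral_mul_cauchyKernel (integrable_const (1 : ℂ)) z
  simp only [one_mul, fourierCoeff, smul_eq_mul, mul_one, integral_fourier] at h
  rw [h, tsum_eq_single 0]
  · simp
  · intro n hn
    simp [hn]

theorem cauchyKernel_zero (t : UnitAddCircle) : cauchyKernel 0 t = 1 := by
  simp [cauchyKernel]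

theorem isBddHardy_conj_cauchyKernel (z : 𝔻) : IsBddHardy fun t => conj (cauchyKernel z t) := by
  refine ⟨(Complex.continuous_conj.comp (continuous_cauchyKernel z)).aestronglyMeasurable,
    ⟨_, ae_of_all _ fun t => (RCLike.norm_conj _).trans_le (norm_cauchyKernel_le z t)⟩,
    fun n hn => ?_⟩
  have h := integral_mul_cauchyKernel (f := fourier (-n))
    ((map_continuous (fourier (-(n : ℤ)))).integrable_of_hasCompactSupport
      (HasCompactSupport.of_compactSpace _)) z
  have h0 : ∫ t, fourier (-n) t * cauchyKernel z t ∂μ₀ = 0 := by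
    rw [h]
    refine (tsum_congr fun k => ?_).trans tsum_zero
    rw [fourierCoeff]
    simp only [smul_eq_mul, ← fourier_add, integral_fourier]
    rw [if_neg (by omega), zero_mul]
  have h1 := congrArg conj h0
  rw [← integral_conj, map_zero] at h1
  rw [← h1]
  refine integral_congr_ae (ae_of_all _ fun t => ?_)
  simp only [map_mul, fourier_neg, Complex.conj_conj]

/-- Pairing with the Cauchy kernel evaluates at `z`. The induction uses `(1 - z ζ̄) · cauchyKernel =
1`: the difference of two consecutive integrands is `ζⁿ⁺¹ f`, which has integral zero. -/
theorem IsHardy.integral_fourier_mul_cauchyKernel {f : UnitAddCircle → ℂ} (hf : IsHardy f)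
    (z : 𝔻) (n : ℕ) : ∫ t, fourier n t * (f t * cauchyKernel z t) ∂μ₀ =
      (z : ℂ) ^ n * ∫ t, f t * cauchyKernel z t ∂μ₀ := by
  induction n with
  | zero => simp
  | succ n ih =>
    rw [pow_succ', mul_assoc, ← ih, ← integral_const_mul, ← sub_eq_zero, ← integral_sub,
      ← hf.2 (n + 1) (by omega)]
    · refine integral_congr_ae (ae_of_all _ fun t => ?_)
      have h1 : (1 - (z : ℂ) * fourier (-1) t) * cauchyKernel z t = 1 :=
        mul_inv_cancel₀ (one_sub_mul_fourier_ne_zero z (-1) t)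
      have h2 : (fourier n t : ℂ) = fourier (-1) t * fourier ((n + 1 : ℕ) : ℤ) t := by
        rw [← fourier_add]
        congr 1
        push_cast
        ring_nf
      simp only
      rw [h2]
      linear_combination (fourier ((n + 1 : ℕ) : ℤ) t * f t) * h1
    · exact (memLp_fourier_mul (memLp_mul_cauchyKernel hf.1 z) _).integrable (by norm_num)
    · exact ((memLp_fourier_mul (memLp_mul_cauchyKernel hf.1 z) _).integrable
        (by norm_num)).const_mul _

/-- The difference quotient of a function in `H^∞`, multiplied by the independent variable. -/
theorem IsBddHardy.sub_mul_cauchyKernel {f : UnitAddCircle → ℂ} (hf : IsBddHardy f) (z : 𝔻)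
    {c : ℂ} (hc : ∫ t, f t * cauchyKernel z t ∂μ₀ = c) :
    IsBddHardy (fun t => (f t - c) * cauchyKernel z t) ∧
      ∫ t, (f t - c) * cauchyKernel z t ∂μ₀ = 0 := by
  have hg : IsBddHardy fun t => f t - c := by
    simpa only [sub_eq_add_neg] using hf.add (isBddHardy_const (-c))
  have h0 : ∫ t, (f t - c) * cauchyKernel z t ∂μ₀ = 0 := by
    simp only [sub_mul]
    rw [integral_sub, hc, integral_const_mul, integral_cauchyKernel, mul_one, sub_self]
    · exact (memLp_mul_cauchyKernel hf.isHardy.1 z).integrable (by norm_num)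
    · exact (memLp_mul_cauchyKernel (isBddHardy_const c).isHardy.1 z).integrable (by norm_num)
  obtain ⟨C, hC⟩ := hg.2
  refine ⟨.of_isHardy ⟨memLp_mul_cauchyKernel hg.isHardy.1 z, fun n _ => ?_⟩
    ⟨C * (1 - ‖(z : ℂ)‖)⁻¹, ?_⟩, h0⟩
  -- The moment is `zⁿ` times the value of `f - c` at `z`, which is zero.
  · rw [hg.isHardy.integral_fourier_mul_cauchyKernel, h0, mul_zero]
  · filter_upwards [hC] with t ht
    rw [norm_mul]
    exact mul_le_mul ht (norm_cauchyKernel_le z t) (norm_nonneg _) ((norm_nonneg _).trans ht)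

/-- The integral over the circle as an average over a circle in the plane. -/
theorem integral_comp_fourier_one (F : ℂ → ℂ) :
    ∫ t, F (fourier 1 t) ∂μ₀ = Real.circleAverage F 0 1 := by
  have h1 := AddCircle.integral_haarAddCircle (T := 1) (f := fun t => F (fourier 1 t))
  rw [inv_one, one_smul] at h1
  rw [h1, ← UnitAddCircle.intervalIntegral_preimage 0, Real.circleAverage_def]
  have h2 := intervalIntegral.smul_integral_comp_mul_left (a := 0) (b := 1)
    (fun θ => F (circleMap 0 1 θ)) (2 * Real.pi)
  rw [mul_zero, mul_one] at h2
  rw [← h2, smul_smul, inv_mul_cancel₀ (by positivity), one_smul, zero_add]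
  refine intervalIntegral.integral_congr fun x _ => ?_
  simp only [fourier_coe_apply, circleMap]
  congr 1
  push_cast
  simp
  congr 1
  ring

/-! ### Boundary values of inner functions -/

namespace InnerFunction

variable (α : InnerFunction)

theorem mul_fourier_mem_ball {r : ℝ} (h0 : 0 < r) (h1 : r < 1) (t : UnitAddCircle) :
    (r : ℂ) * fourier 1 t ∈ Metric.ball (0 : ℂ) 1 := by
  rw [mem_ball_zero_iff, norm_mul, norm_fourier_apply, mul_one, Complex.norm_real,
    Real.norm_eq_abs, abs_of_pos h0]
  exact h1

theorem eventually_mem_Ioo : ∀ᶠ r : ℝ in 𝓝[<] (1 : ℝ), 0 < r ∧ r < 1 := by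
  filter_upwards [Ioo_mem_nhdsLT (zero_lt_one (α := ℝ))] with r hr
  exact hr

/-- Dominated convergence, with the bound on `α`. Integral identities for the dilations, which are
analytic across the circle, thereby pass to the boundary function. -/
theorem tendsto_integral_dilation {w : UnitAddCircle → ℂ} (hw : Continuous w) :
    Tendsto (fun r : ℝ => ∫ t, w t * α.toFun (r * fourier 1 t) ∂μ₀) (𝓝[<] (1 : ℝ))
      (𝓝 (∫ t, w t * α.bdry t ∂μ₀)) := by
  obtain ⟨C, hC⟩ := α.bounded
  refine tendsto_integral_filter_of_dominated_convergence (fun t => ‖w t‖ * C) ?_ ?_ ?_ ?_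
  · filter_upwards [eventually_mem_Ioo] with r hr
    refine (hw.mul (α.analytic.continuousOn.comp_continuous
      (continuous_const.mul (map_continuous (fourier 1))) fun t => ?_)).aestronglyMeasurable
    exact mul_fourier_mem_ball hr.1 hr.2 t
  · filter_upwards [eventually_mem_Ioo] with r hr
    refine ae_of_all _ fun t => ?_
    rw [norm_mul]
    exact mul_le_mul_of_nonneg_left (hC _ (mul_fourier_mem_ball hr.1 hr.2 t)) (norm_nonneg _)
  · exact (hw.norm.mul continuous_const).integrable_of_hasCompactSupport
      (HasCompactSupport.of_compactSpace _)
  · filter_upwards [α.unimodular] with t ⟨ζ, hζ, _⟩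
    rw [bdry, boundaryValue, hζ.limUnder_eq]
    exact hζ.const_mul _

theorem differentiableOn_dilation {r : ℝ} (h0 : 0 < r) (h1 : r < 1) :
    DiffContOnCl ℂ (fun ζ => α.toFun (r * ζ)) (Metric.ball 0 |1|) := by
  refine DifferentiableOn.diffContOnCl ?_
  rw [abs_one]
  refine α.analytic.comp (differentiableOn_const _ |>.mul differentiableOn_id) fun ζ hζ => ?_
  have h2 : ‖ζ‖ ≤ 1 := by simpa using Metric.closure_ball_subset_closedBall hζ
  rw [mem_ball_zero_iff, norm_mul, Complex.norm_real, Real.norm_eq_abs, abs_of_pos h0]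
  nlinarith

/-- The mean value property of `ζⁿ α(rζ)`, which vanishes at the origin for `n ≠ 0`, in the limit `r
→ 1`. -/
theorem isBddHardy_bdry : IsBddHardy α.bdry := by
  refine ⟨α.aestronglyMeasurable_bdry, ⟨1, α.norm_bdry.mono fun t ht => ht.le⟩, fun n hn => ?_⟩
  refine tendsto_nhds_unique (α.tendsto_integral_dilation (map_continuous (fourier n))) ?_
  refine tendsto_const_nhds.congr' ?_
  filter_upwards [eventually_mem_Ioo] with r hr
  have h : DiffContOnCl ℂ (fun ζ : ℂ => ζ ^ n * α.toFun (r * ζ)) (Metric.ball 0 |1|) :=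
    (differentiable_pow n).diffContOnCl.smul (α.differentiableOn_dilation hr.1 hr.2)
  have h2 := h.circleAverage
  rw [← integral_comp_fourier_one, zero_pow hn, zero_mul] at h2
  rw [← h2]
  refine integral_congr_ae (ae_of_all _ fun t => ?_)
  simp only
  congr 1
  clear h h2 hn
  induction n with
  | zero => simp
  | succ n ih => rw [pow_succ, ih, ← fourier_add, Nat.cast_succ]

/-- Cauchy's formula for `ζ ↦ α(rζ)` at `z`, in the limit `r → 1`; it ties the values of `α` in the
disc to its boundary function. -/
theorem integral_bdry_mul_cauchyKernel (z : 𝔻) :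
    ∫ t, α.bdry t * cauchyKernel z t ∂μ₀ = α.toFun z := by
  have h1 := α.tendsto_integral_dilation (continuous_cauchyKernel z)
  have h2 : Tendsto (fun r : ℝ => α.toFun (r * z)) (𝓝[<] (1 : ℝ)) (𝓝 (α.toFun z)) := by
    have hz : (z : ℂ) ∈ Metric.ball (0 : ℂ) 1 := by
      rw [mem_ball_zero_iff]
      exact z.norm_lt_one
    have hc : ContinuousAt α.toFun z :=
      α.analytic.continuousOn.continuousAt (Metric.isOpen_ball.mem_nhds hz)
    refine hc.tendsto.comp ?_
    have h3 : Continuous fun r : ℝ => (r : ℂ) * z :=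
      Complex.continuous_ofReal.mul continuous_const
    have h4 := h3.tendsto 1
    rw [Complex.ofReal_one, one_mul] at h4
    exact h4.mono_left nhdsWithin_le_nhds
  simp only [mul_comm (α.bdry _)]
  refine tendsto_nhds_unique h1 (h2.congr' ?_)
  filter_upwards [eventually_mem_Ioo] with r hr
  have h5 := (α.differentiableOn_dilation hr.1 hr.2).circleAverage_smul_div (w := z)
    (by rw [abs_one, mem_ball_zero_iff]; exact z.norm_lt_one)
  rw [← h5, ← integral_comp_fourier_one]
  refine integral_congr_ae (ae_of_all _ fun t => ?_)
  simp only [smul_eq_mul, sub_zero]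
  congr 1
  have h6 : (fourier 1 t : ℂ) * fourier (-1) t = 1 := by
    rw [← fourier_add]
    simp
  have h7 : (fourier 1 t : ℂ) - z = fourier 1 t * (1 - z * fourier (-1) t) := by
    linear_combination (z : ℂ) * h6
  have h8 : (fourier 1 t : ℂ) ≠ 0 := left_ne_zero_of_mul_eq_one h6
  rw [h7, cauchyKernel, div_mul_eq_div_div, div_self h8, one_div]

theorem integral_bdry : ∫ t, α.bdry t ∂μ₀ = α.toFun 0 := by
  have h := α.integral_bdry_mul_cauchyKernel 0
  simpa only [cauchyKernel_zero, mul_one, Complex.UnitDisc.coe_zero] using h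

theorem bdry_mul_conj : ∀ᵐ t ∂μ₀, α.bdry t * conj (α.bdry t) = 1 := by
  filter_upwards [α.norm_bdry] with t ht
  rw [Complex.mul_conj, Complex.normSq_eq_norm_sq, ht]
  norm_num

/-! ### Model spaces and their reproducing kernels -/

theorem kernelFun_eq (w : 𝔻) (t : UnitAddCircle) : α.kernelFun w t =
    (1 - conj (α.toFun w) * α.bdry t) * conj (cauchyKernel w t) := by
  rw [kernelFun, conj_cauchyKernel, div_eq_mul_inv]

theorem isBddHardy_one_sub (c : ℂ) : IsBddHardy fun t => 1 - c * α.bdry t := by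
  simpa only [neg_mul, ← sub_eq_add_neg] using
    (isBddHardy_const 1).add (α.isBddHardy_bdry.const_mul (-c))

theorem isBddHardy_kernelFun (w : 𝔻) : IsBddHardy (α.kernelFun w) := by
  rw [funext (α.kernelFun_eq w)]
  exact (α.isBddHardy_one_sub _).mul (isBddHardy_conj_cauchyKernel w)

theorem integral_mul_conj_eq_zero {f h : UnitAddCircle → ℂ}
    (horth : ∀ u : L2, u ∈ α.mulH2 → ∫ t, f t * conj (u t) ∂μ₀ = 0) (hh : IsHardy h) :
    ∫ t, f t * conj (α.bdry t * h t) ∂μ₀ = 0 := by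
  have hm := (α.isBddHardy_bdry.mul_isHardy hh).memLp
  rw [← horth (hm.toLp _) ⟨hh.memLp.toLp h, hh.toLp_mem, ?_⟩]
  · refine integral_congr_ae ?_
    filter_upwards [hm.coeFn_toLp] with t ht
    rw [ht]
  · filter_upwards [hm.coeFn_toLp, hh.memLp.coeFn_toLp] with t h1 h2
    rw [h1, h2]

/-- Functions on the circle that represent an element of `K_α`. -/
def IsModel (f : UnitAddCircle → ℂ) : Prop :=
  IsHardy f ∧ ∀ h, IsHardy h → ∫ t, f t * conj (α.bdry t * h t) ∂μ₀ = 0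

theorem inner_eq_integral (u f : L2) : inner ℂ u f = ∫ t, f t * conj (u t) ∂μ₀ := by
  rw [L2.inner_def]
  rfl

theorem mem_K_iff (f : L2) : f ∈ α.K ↔ α.IsModel f := by
  constructor
  · rintro ⟨h1, h2⟩
    have h1 := (mem_H2_iff f).1 h1
    refine ⟨h1, fun h hh => α.integral_mul_conj_eq_zero (fun u hu => ?_) hh⟩
    rw [← inner_eq_integral]
    exact (Submodule.mem_orthogonal _ _).1 h2 u hu
  · rintro ⟨h1, h2⟩
    refine ⟨(mem_H2_iff f).2 h1, (Submodule.mem_orthogonal _ _).2 ?_⟩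
    rintro u ⟨h, hh, hu⟩
    rw [inner_eq_integral, ← h2 h ((mem_H2_iff h).1 hh)]
    refine integral_congr_ae ?_
    filter_upwards [hu] with t ht
    rw [ht]

theorem IsModel.congr {α : InnerFunction} {f g : UnitAddCircle → ℂ} (hf : α.IsModel f)
    (h : g =ᵐ[μ₀] f) : α.IsModel g := by
  refine ⟨hf.1.congr h, fun k hk => ?_⟩
  rw [← hf.2 k hk]
  refine integral_congr_ae ?_
  filter_upwards [h] with t ht
  rw [ht]

theorem IsModel.toLp_mem {α : InnerFunction} {f : UnitAddCircle → ℂ} (hf : α.IsModel f) :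
    hf.1.memLp.toLp f ∈ α.K :=
  (α.mem_K_iff _).2 (hf.congr hf.1.memLp.coeFn_toLp)

/-- On the circle, `α` times the conjugate of the kernel is a multiple of a difference quotient. -/
theorem bdry_mul_conj_kernelFun (z : 𝔻) : ∀ᵐ t ∂μ₀,
    α.bdry t * conj (α.kernelFun z t) = (α.bdry t - α.toFun z) * cauchyKernel z t := by
  filter_upwards [α.bdry_mul_conj] with t ht
  simp only [kernelFun_eq, map_mul, map_sub, map_one, Complex.conj_conj]
  linear_combination (-α.toFun z * cauchyKernel z t) * ht

theorem isBddHardy_quotient (z : 𝔻) :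
    IsBddHardy (fun t => (α.bdry t - α.toFun z) * cauchyKernel z t) ∧
      ∫ t, (α.bdry t - α.toFun z) * cauchyKernel z t ∂μ₀ = 0 :=
  α.isBddHardy_bdry.sub_mul_cauchyKernel z (α.integral_bdry_mul_cauchyKernel z)

/-- `β h f` is annihilated by the kernels of `K_β`, for `h` and `f` in `H²`. -/
theorem integral_bdry_mul_mul_conj_kernelFun {f h : UnitAddCircle → ℂ} (hf : IsHardy f)
    (hh : IsHardy h) (z : 𝔻) :
    ∫ t, α.bdry t * h t * f t * conj (α.kernelFun z t) ∂μ₀ = 0 := by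
  obtain ⟨h1, h2⟩ := α.isBddHardy_quotient z
  have h3 := (h1.mul_isHardy hh).integral_mul hf
  rw [h1.isHardy.integral_mul hh, h2, zero_mul, zero_mul] at h3
  rw [← h3]
  refine integral_congr_ae ?_
  filter_upwards [α.bdry_mul_conj_kernelFun z] with t ht
  linear_combination (h t * f t) * ht

theorem isModel_kernelFun (w : 𝔻) : α.IsModel (α.kernelFun w) := by
  refine ⟨(α.isBddHardy_kernelFun w).isHardy, fun h hh => ?_⟩
  have h1 := congrArg conj
    (α.integral_bdry_mul_mul_conj_kernelFun (isBddHardy_const 1).isHardy hh w)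
  rw [← integral_conj, map_zero] at h1
  rw [← h1]
  refine integral_congr_ae (ae_of_all _ fun t => ?_)
  simp only [map_mul, Complex.conj_conj, map_one]
  ring

/-- The reproducing property. -/
theorem IsModel.integral_mul_conj_kernelFun {α : InnerFunction} {f : UnitAddCircle → ℂ}
    (hf : α.IsModel f) (z : 𝔻) :
    ∫ t, f t * conj (α.kernelFun z t) ∂μ₀ = ∫ t, f t * cauchyKernel z t ∂μ₀ := by
  -- The two integrals differ by `α(z)` times the pairing of `f` with `α · conj (cauchyKernel z)`,
  -- an element of `αH²`.
  have h1 := hf.2 _ (isBddHardy_conj_cauchyKernel z).isHardy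
  rw [← sub_eq_zero, ← integral_sub, ← neg_eq_zero, ← integral_neg]
  · have h2 := congrArg (fun x => α.toFun z * x) h1
    simp only [mul_zero] at h2
    rw [← integral_const_mul] at h2
    rw [← h2]
    refine integral_congr_ae (ae_of_all _ fun t => ?_)
    simp only [kernelFun_eq, map_mul, map_sub, map_one, Complex.conj_conj]
    ring
  · exact integrable_mul_of_memLp hf.1.1 (memLp_conj (α.isBddHardy_kernelFun z).isHardy.1)
  · exact (memLp_mul_cauchyKernel hf.1.1 z).integrable (by norm_num)

/-- The function `(α - α(0)) / z`, the image of `α` under the backward shift. -/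
def backwardShift (t : UnitAddCircle) : ℂ := (α.bdry t - α.toFun 0) * fourier (-1) t

/-- A second bounded element of `K_α`, needed because the kernels at the origin of `K_α` and `K_β`
may be orthogonal to each other. -/
theorem isModel_backwardShift : α.IsModel α.backwardShift := by
  have h0 : IsBddHardy fun t => α.bdry t - α.toFun 0 := by
    simpa only [sub_eq_add_neg] using α.isBddHardy_bdry.add (isBddHardy_const (-α.toFun 0))
  have hm : MemLp α.backwardShift 2 μ₀ := by
    have := memLp_fourier_mul h0.isHardy.1 (-1)
    simp only [mul_comm (fourier (-1) _)] at this
    exact this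
  have hint : ∫ t, α.bdry t - α.toFun 0 ∂μ₀ = 0 := by
    rw [integral_sub α.isBddHardy_bdry.isHardy.integrable (integrable_const _), integral_bdry,
      integral_const_haar, sub_self]
  refine ⟨⟨hm, fun n hn => ?_⟩, fun h hh => ?_⟩
  · obtain ⟨k, rfl⟩ := Nat.exists_eq_succ_of_ne_zero hn
    have h1 : ∫ t, fourier k t * (α.bdry t - α.toFun 0) ∂μ₀ = 0 := by
      rcases eq_or_ne k 0 with rfl | hk
      · simpa using hint
      · exact h0.3 k hk
    rw [← h1]
    refine integral_congr_ae (ae_of_all _ fun t => ?_)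
    have h2 : (fourier k t : ℂ) = fourier (k.succ : ℤ) t * fourier (-1) t := by
      rw [← fourier_add]
      congr 1
      push_cast
      ring_nf
    simp only [backwardShift, h2]
    ring
  · have h1 := hh.fourier_mul 1
    have h3 := hh.2 1 one_ne_zero
    rw [Nat.cast_one] at h3
    simp only [Nat.cast_one] at h1
    -- On the circle this integrand is the conjugate of the one in the orthogonality relation; both
    -- of its summands vanish at the origin.
    have h2 : ∫ t, fourier 1 t * h t + α.bdry t * (-conj (α.toFun 0) * (fourier 1 t * h t)) ∂μ₀
        = 0 := by
      rw [integral_add h1.integrable (α.isBddHardy_bdry.mul_isHardy (h1.const_mul _)).integrable,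
        h3, α.isBddHardy_bdry.isHardy.integral_mul (h1.const_mul _), integral_const_mul, h3]
      simp
    have h4 := congrArg conj h2
    rw [← integral_conj, map_zero] at h4
    rw [← h4]
    refine integral_congr_ae ?_
    filter_upwards [α.bdry_mul_conj] with t ht
    simp only [backwardShift, fourier_neg, map_add, map_mul, map_neg, Complex.conj_conj]
    linear_combination (conj (fourier 1 t) * conj (h t)) * ht

theorem norm_backwardShift_le : ∃ C : ℝ, ∀ᵐ t ∂μ₀, ‖α.backwardShift t‖ ≤ C := by
  refine ⟨1 + ‖α.toFun 0‖, ?_⟩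
  filter_upwards [α.norm_bdry] with t ht
  rw [backwardShift, norm_mul, norm_fourier_apply, mul_one, ← ht]
  exact norm_sub_le _ _

end InnerFunction

/-! ### Closedness and orthogonal decompositions -/

theorem isClosed_H2 : IsClosed (H2 : Set L2) := by
  have h : (H2 : Set L2) = ⋂ n : ℤ, ⋂ _ : n < 0, {f : L2 | inner ℂ (fourierBasis n) f = 0} := by
    ext f
    simp only [Set.mem_iInter, Set.mem_ofPred_eq, ← HilbertBasis.repr_apply_apply,
      fourierBasis_repr]
    rfl
  rw [h]
  exact isClosed_iInter fun n => isClosed_iInter fun _ =>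
    isClosed_eq (continuous_const.inner continuous_id) continuous_const

/-- Orthogonality to `ζⁿ` for `n > 0` removes the positive frequencies of `f`, that is, the negative
ones of its conjugate. -/
theorem star_mem_H2_of_orthogonal {f : L2} (hf : f ∈ H2ᗮ) : star f ∈ H2 := by
  rw [mem_H2_iff]
  refine ⟨Lp.memLp _, fun n _ => ?_⟩
  have hn : IsHardy fun t => fourier n t * 1 := (isBddHardy_const 1).isHardy.fourier_mul n
  have h1 := congrArg conj ((Submodule.mem_orthogonal _ _).1 hf _ hn.toLp_mem)
  rw [InnerFunction.inner_eq_integral, ← integral_conj, map_zero] at h1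
  rw [← h1]
  refine integral_congr_ae ?_
  filter_upwards [hn.memLp.coeFn_toLp, Lp.coeFn_star f] with t h2 h3
  rw [h2, h3]
  simp only [map_mul, Complex.conj_conj, mul_one, Pi.star_apply, RCLike.star_def]
  ring

namespace InnerFunction

variable (α β : InnerFunction)

/-- Since `|α| = 1` on the circle, `f ∈ αH²` exactly when `conj α · f ∈ H²`, a family of closed
linear conditions. -/
theorem isClosed_mulH2 : IsClosed (α.mulH2 : Set L2) := by
  have hm : ∀ n : ℤ, MemLp (fun t => fourier (-n) t * α.bdry t) 2 μ₀ := fun n =>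
    memLp_fourier_mul α.isBddHardy_bdry.isHardy.1 _
  have key : ∀ (f : L2) (n : ℤ), inner ℂ ((hm n).toLp _) f =
      ∫ t, fourier n t * (conj (α.bdry t) * f t) ∂μ₀ := by
    intro f n
    rw [inner_eq_integral]
    refine integral_congr_ae ?_
    filter_upwards [(hm n).coeFn_toLp] with t ht
    rw [ht]
    simp only [map_mul, fourier_neg, Complex.conj_conj]
    ring
  have h : (α.mulH2 : Set L2) =
      ⋂ n : ℕ, ⋂ _ : n ≠ 0, {f : L2 | inner ℂ ((hm n).toLp _) f = 0} := by
    ext f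
    simp only [Set.mem_iInter, Set.mem_ofPred_eq, key]
    constructor
    · rintro ⟨h, hh, hf⟩ n hn
      rw [← ((mem_H2_iff h).1 hh).2 n hn]
      refine integral_congr_ae ?_
      filter_upwards [hf, α.bdry_mul_conj] with t h1 h2
      simp only [h1]
      linear_combination (fourier n t * h t) * h2
    · intro hf
      have hh : IsHardy fun t => conj (α.bdry t) * f t := by
        refine ⟨memLp_bdd_mul (memLp_conj α.isBddHardy_bdry.isHardy.1).1 ⟨1, ?_⟩ (Lp.memLp f), hf⟩
        filter_upwards [α.norm_bdry] with t ht
        rw [RCLike.norm_conj, ht]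
      refine ⟨_, hh.toLp_mem, ?_⟩
      filter_upwards [hh.memLp.coeFn_toLp, α.bdry_mul_conj] with t h1 h2
      rw [h1]
      linear_combination (-f t) * h2
  rw [h]
  exact isClosed_iInter fun n => isClosed_iInter fun _ =>
    isClosed_eq (continuous_const.inner continuous_id) continuous_const

theorem isClosed_K : IsClosed (α.K : Set L2) :=
  isClosed_H2.inter α.mulH2.isClosed_orthogonal

theorem mulH2_le_H2 : α.mulH2 ≤ H2 := by
  rintro f ⟨h, hh, hf⟩
  exact (mem_H2_iff f).2 ((α.isBddHardy_bdry.mul_isHardy ((mem_H2_iff h).1 hh)).congr hf)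

theorem exists_mem_K_add {f : L2} (hf : f ∈ H2) :
    ∃ χ ∈ α.K, ∃ p, IsHardy p ∧ f =ᵐ[μ₀] fun t => χ t + α.bdry t * p t := by
  have := α.isClosed_mulH2.completeSpace_coe
  obtain ⟨u, hu, χ, hχ, rfl⟩ := α.mulH2.exists_add_mem_mem_orthogonal f
  refine ⟨χ, ⟨?_, hχ⟩, ?_⟩
  · simpa using H2.sub_mem hf (α.mulH2_le_H2 hu)
  · obtain ⟨p, hp, hu⟩ := hu
    refine ⟨p, (mem_H2_iff p).1 hp, ?_⟩
    filter_upwards [hu, Lp.coeFn_add u χ] with t h1 h2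
    rw [h2, Pi.add_apply, h1, add_comm]

end InnerFunction

open InnerFunction

variable {α β : InnerFunction}

/-! ### Symbols of the zero operator and existence -/

theorem atto_eq_iff {φ₁ φ₂ : L2} :
    atto α β φ₁ = atto α β φ₂ ↔ attoGraph α β φ₁ = attoGraph α β φ₂ := by
  rw [← atto_graph, ← atto_graph]
  exact ⟨fun h => by rw [h], LinearPMap.eq_of_eq_graph⟩

theorem atto_eq_of_ae_eq_add {φ₁ φ₂ : L2} {p q : UnitAddCircle → ℂ} (hp : IsHardy p)
    (hq : IsHardy q)
    (h : φ₁ =ᵐ[μ₀] fun t => φ₂ t + conj (α.bdry t * p t) + β.bdry t * q t) :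
    atto α β φ₁ = atto α β φ₂ := by
  rw [atto_eq_iff]
  have key : ∀ (f : α.K) (z : 𝔻), β.proj (fun t => φ₁ t * (f : L2) t) z =
      β.proj (fun t => φ₂ t * (f : L2) t) z := by
    intro f z
    have hf := (α.mem_K_iff f).1 f.2
    have hk := β.isBddHardy_kernelFun z
    have hpk := hk.mul_isHardy hp
    -- The term `conj (αp)` pairs `f` with `α k_z p ∈ αH²`.
    have h1 := hf.2 _ hpk
    have h2 := β.integral_bdry_mul_mul_conj_kernelFun hf.1 hq z
    have i0 := β.integrable_proj φ₂ f z
    have i1 : Integrable (fun t => (f : L2) t * conj (α.bdry t * (β.kernelFun z t * p t))) μ₀ :=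
      integrable_mul_of_memLp hf.1.1 (memLp_conj (α.isBddHardy_bdry.mul_isHardy hpk).1)
    have i2 : Integrable
        (fun t => β.bdry t * q t * (f : L2) t * conj (β.kernelFun z t)) μ₀ := by
      have h3 := integrable_mul_of_memLp (memLp_conj hk.isHardy.1)
        (β.isBddHardy_bdry.mul_isHardy hq).1
      have i3 := integrable_mul_of_memLp
        (memLp_bdd_mul (memLp_conj hk.isHardy.1).1
          (hk.bounded.imp fun C hC => hC.mono fun t ht => (RCLike.norm_conj _).trans_le ht)
          (β.isBddHardy_bdry.mul_isHardy hq).1) hf.1.1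
      refine i3.congr (ae_of_all _ fun t => ?_)
      simp only
      ring
    rw [InnerFunction.proj, InnerFunction.proj]
    calc _ = ∫ t, φ₂ t * (f : L2) t * conj (β.kernelFun z t) +
          (f : L2) t * conj (α.bdry t * (β.kernelFun z t * p t)) +
          β.bdry t * q t * (f : L2) t * conj (β.kernelFun z t) ∂μ₀ := by
          refine integral_congr_ae ?_
          filter_upwards [h] with t ht
          rw [ht]
          simp only [map_mul]
          ring
      _ = _ := by
          rw [((HasIntegralEq.add ⟨i0, rfl⟩ ⟨i1, h1⟩).add ⟨i2, h2⟩).2, add_zero, add_zero]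
  ext ⟨f, g⟩
  exact forall_congr' fun z => by rw [key]

theorem exists_atto_eq (α β : InnerFunction) (φ : L2) :
    ∃ χ ∈ α.K, ∃ ψ ∈ β.K, atto α β φ = atto α β (star χ + ψ) := by
  have := isClosed_H2.completeSpace_coe
  obtain ⟨g, hg, e, he, rfl⟩ := H2.exists_add_mem_mem_orthogonal φ
  obtain ⟨ψ, hψ, q, hq, hgq⟩ := β.exists_mem_K_add hg
  obtain ⟨χ, hχ, p, hp, hep⟩ := α.exists_mem_K_add (star_mem_H2_of_orthogonal he)
  refine ⟨χ, hχ, ψ, hψ, atto_eq_of_ae_eq_add hp hq ?_⟩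
  filter_upwards [hgq, hep, Lp.coeFn_add g e, Lp.coeFn_star e, Lp.coeFn_add (star χ) ψ,
    Lp.coeFn_star χ] with t h1 h2 h3 h4 h5 h6
  have h7 : e t = conj (χ t) + conj (α.bdry t * p t) := by
    rw [← map_add, ← h2, h4]
    simp
  rw [h3, h5, Pi.add_apply, Pi.add_apply, h6, h1, h7]
  simp only [Pi.star_apply, RCLike.star_def]
  ring

/-! ### The sesquilinear form of the operator -/

/-- The compression of multiplication by `φ` to a bounded function in the domain. -/
theorem exists_mem_attoGraph (φ : L2) {f : UnitAddCircle → ℂ} (hf : α.IsModel f)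
    (hb : ∃ C : ℝ, ∀ᵐ t ∂μ₀, ‖f t‖ ≤ C) :
    ∃ g : β.K, ((⟨hf.1.memLp.toLp f, hf.toLp_mem⟩, g) : α.K × β.K) ∈ attoGraph α β φ ∧
      ∀ k, β.IsModel k →
        ∫ t, φ t * f t * conj (k t) ∂μ₀ = ∫ t, (g : L2) t * conj (k t) ∂μ₀ := by
  -- For bounded `f` the product lies in `L²`, so the extended `P_β` agrees with the orthogonal
  -- projection, whose component in `K_β` is taken as `g`.
  have hm : MemLp (fun t => f t * φ t) 2 μ₀ := memLp_bdd_mul hf.1.1.1 hb (Lp.memLp φ)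
  have := β.isClosed_K.completeSpace_coe
  obtain ⟨g, hg, r, hr, hgr⟩ := β.K.exists_add_mem_mem_orthogonal (hm.toLp _)
  have key : ∀ k, β.IsModel k →
      ∫ t, φ t * f t * conj (k t) ∂μ₀ = ∫ t, g t * conj (k t) ∂μ₀ := by
    intro k hk
    have h1 := (Submodule.mem_orthogonal _ _).1 hr _ hk.toLp_mem
    rw [inner_eq_integral] at h1
    have h2 : ∫ t, r t * conj (k t) ∂μ₀ = 0 := by
      rw [← h1]
      refine integral_congr_ae ?_
      filter_upwards [hk.1.memLp.coeFn_toLp] with t ht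
      rw [ht]
    rw [← add_zero (∫ t, g t * conj (k t) ∂μ₀), ← h2, ← integral_add
      (integrable_mul_of_memLp (Lp.memLp g) (memLp_conj hk.1.1))
      (integrable_mul_of_memLp (Lp.memLp r) (memLp_conj hk.1.1))]
    refine integral_congr_ae ?_
    filter_upwards [hm.coeFn_toLp, Lp.coeFn_add g r] with t h3 h4
    rw [hgr, h4, Pi.add_apply] at h3
    linear_combination (-conj (k t)) * h3
  refine ⟨⟨g, hg⟩, fun z => ?_, key⟩
  change diskValue g z = _
  rw [diskValue_eq_integral, ← ((β.mem_K_iff g).1 hg).integral_mul_conj_kernelFun z,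
    ← key _ (β.isModel_kernelFun z), InnerFunction.proj]
  refine integral_congr_ae ?_
  filter_upwards [hf.1.memLp.coeFn_toLp] with t ht
  simp only [ht]

/-- Bounded elements of `K_α` lie in both domains, so equality of the partial operators can be
tested on them. -/
theorem integral_sub_mul_eq_zero_of_atto_eq {φ₁ φ₂ : L2} (h : atto α β φ₁ = atto α β φ₂)
    {f g : UnitAddCircle → ℂ} (hf : α.IsModel f) (hfb : ∃ C : ℝ, ∀ᵐ t ∂μ₀, ‖f t‖ ≤ C)
    (hg : β.IsModel g) : ∫ t, (φ₁ t - φ₂ t) * f t * conj (g t) ∂μ₀ = 0 := by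
  obtain ⟨g₁, h1, h1'⟩ := exists_mem_attoGraph (β := β) φ₁ hf hfb
  obtain ⟨g₂, h2, h2'⟩ := exists_mem_attoGraph (β := β) φ₂ hf hfb
  have h3 : g₁ = g₂ := by
    rw [atto_eq_iff.1 h] at h1
    rw [← atto_graph] at h1 h2
    exact LinearPMap.mem_graph_snd_inj _ h1 h2 rfl
  have hi : ∀ φ : L2, Integrable (fun t => φ t * f t * conj (g t)) μ₀ := by
    intro φ
    refine (integrable_mul_of_memLp (memLp_bdd_mul hf.1.1.1 hfb (Lp.memLp φ))
      (memLp_conj hg.1.1)).congr (ae_of_all _ fun t => ?_)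
    simp only
    ring
  simp only [sub_mul]
  rw [integral_sub (hi φ₁) (hi φ₂), h1' g hg, h2' g hg, h3, sub_self]

theorem IsHardy.ae_eq_zero {f : UnitAddCircle → ℂ} (hf : IsHardy f)
    (h : ∀ z : 𝔻, ∫ t, f t * cauchyKernel z t ∂μ₀ = 0) : f =ᵐ[μ₀] 0 := by
  have h1 : hf.memLp.toLp f = 0 := by
    refine eq_zero_of_diskValue_eq_zero hf.toLp_mem fun z => ?_
    rw [diskValue_eq_integral, ← h z]
    refine integral_congr_ae ?_
    filter_upwards [hf.memLp.coeFn_toLp] with t ht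
    rw [ht]
  exact hf.memLp.coeFn_toLp.symm.trans ((Lp.eq_zero_iff_ae_eq_zero).1 h1)

theorem IsBddHardy.norm_conj_le {f : UnitAddCircle → ℂ} (hf : IsBddHardy f) :
    ∃ C : ℝ, ∀ᵐ t ∂μ₀, ‖conj (f t)‖ ≤ C := by
  simpa only [RCLike.norm_conj] using hf.bounded

theorem hasIntegralEq_const (c : ℂ) : HasIntegralEq (fun _ => c) c :=
  ⟨integrable_const _, integral_const_haar c⟩

/-! ### Uniqueness of the symbol -/

/-- If `P(z) + R(w) = b(z) B(w) + a(w) Q(z) + C` with `a` nonconstant, then `P` is an affine function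
of `b`. -/
theorem exists_eq_add_mul {Z W : Type*} {P b Q : Z → ℂ} {R B a : W → ℂ} {C : ℂ}
    (h : ∀ z w, P z + R w = b z * B w + a w * Q z + C) {w₁ w₂ : W} (hw : a w₁ ≠ a w₂) :
    ∃ u v : ℂ, ∀ z, P z = u + v * b z := by
  have hd : a w₁ - a w₂ ≠ 0 := sub_ne_zero.2 hw
  refine ⟨a w₁ * (R w₁ - R w₂) / (a w₁ - a w₂) + C - R w₁,
    B w₁ - a w₁ * (B w₁ - B w₂) / (a w₁ - a w₂), fun z => ?_⟩
  have h1 := h z w₁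
  have h2 := h z w₂
  -- Subtracting the equations at `w₁` and `w₂` eliminates `P` and makes `Q` affine in `b`.
  have hQ : Q z = (R w₁ - R w₂ - b z * (B w₁ - B w₂)) / (a w₁ - a w₂) := by
    rw [eq_div_iff hd]
    linear_combination h2 - h1
  rw [hQ] at h1
  rw [eq_sub_of_add_eq h1]
  ring

namespace InnerFunction

variable (α : InnerFunction)

theorem exists_toFun_ne (hα : ¬ α.IsConstant) : ∃ w₁ w₂ : 𝔻, α.toFun w₁ ≠ α.toFun w₂ := by
  by_contra! h
  exact hα ⟨α.toFun (0 : 𝔻), fun z => h z 0⟩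

theorem kernelFun_zero (t : UnitAddCircle) :
    α.kernelFun 0 t = 1 - conj (α.toFun 0) * α.bdry t := by
  simp [kernelFun]

theorem hasIntegralEq_bdry : HasIntegralEq α.bdry (α.toFun 0) :=
  ⟨α.isBddHardy_bdry.isHardy.integrable, α.integral_bdry⟩

/-- An element of `K_α` that is an affine function of `α` is a multiple of `k_0^α`. -/
theorem IsModel.ae_eq_kernelFun {α : InnerFunction} {f : UnitAddCircle → ℂ} (hf : α.IsModel f)
    {u v : ℂ} (h : ∀ z : 𝔻, ∫ t, f t * cauchyKernel z t ∂μ₀ = u + v * α.toFun z) :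
    f =ᵐ[μ₀] fun t => u * α.kernelFun 0 t := by
  have hg := (isBddHardy_const u).isHardy.add (α.isBddHardy_bdry.isHardy.const_mul v)
  have h0 : (fun t => f t + -1 * (u + v * α.bdry t)) =ᵐ[μ₀] 0 := by
    refine (hf.1.add (hg.const_mul (-1))).ae_eq_zero fun z => ?_
    have i1 : HasIntegralEq (fun t => f t * cauchyKernel z t) (u + v * α.toFun z) :=
      ⟨(memLp_mul_cauchyKernel hf.1.1 z).integrable (by norm_num), h z⟩
    have i2 : HasIntegralEq (cauchyKernel z) 1 :=
      ⟨(continuous_cauchyKernel z).integrable_of_hasCompactSupport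
        (HasCompactSupport.of_compactSpace _), integral_cauchyKernel z⟩
    have i3 : HasIntegralEq (fun t => α.bdry t * cauchyKernel z t) (α.toFun z) :=
      ⟨(memLp_mul_cauchyKernel α.isBddHardy_bdry.isHardy.1 z).integrable (by norm_num),
        α.integral_bdry_mul_cauchyKernel z⟩
    have i4 := ((i1.add (i2.const_mul (-u))).add (i3.const_mul (-v))).2
    refine Eq.trans (integral_congr_ae (ae_of_all _ fun t => ?_)) (i4.trans (by ring))
    simp only
    ring
  -- Orthogonality of `f = u + vα` to `α · 1` fixes the ratio of the coefficients.
  have h1 : v = -u * conj (α.toFun 0) := by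
    have h2 := hf.2 _ (isBddHardy_const 1).isHardy
    have i := (((α.hasIntegralEq_bdry.conj_eq).const_mul u).add (hasIntegralEq_const v)).2
    have h3 : u * conj (α.toFun 0) + v = 0 := by
      rw [← i, ← h2]
      refine integral_congr_ae ?_
      filter_upwards [h0, α.bdry_mul_conj] with t ht ht'
      have ht : f t + -1 * (u + v * α.bdry t) = 0 := ht
      simp only [map_mul, map_one]
      linear_combination (-conj (α.bdry t)) * ht - v * ht'
    linear_combination h3
  filter_upwards [h0] with t ht
  have ht : f t + -1 * (u + v * α.bdry t) = 0 := ht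
  rw [kernelFun_zero]
  linear_combination ht + α.bdry t * h1

/-- If `|α(0)| = 1`, then `‖α - α(0)‖² = 2 - 2|α(0)|² = 0`, so `α` would be constant. -/
theorem toFun_zero_mul_conj_ne_one (hα : ¬ α.IsConstant) :
    α.toFun 0 * conj (α.toFun 0) ≠ 1 := by
  intro h
  have hd : IsHardy fun t => α.bdry t - α.toFun 0 := by
    simpa only [sub_eq_add_neg] using
      (α.isBddHardy_bdry.add (isBddHardy_const (-α.toFun 0))).isHardy
  have h1 : inner ℂ (hd.memLp.toLp _) (hd.memLp.toLp _) = (0 : ℂ) := by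
    have i := ((hasIntegralEq_const 2).add
      ((α.hasIntegralEq_bdry.conj_eq.const_mul (-α.toFun 0)).add
        (α.hasIntegralEq_bdry.const_mul (-conj (α.toFun 0))))).2
    rw [inner_eq_integral]
    refine Eq.trans (integral_congr_ae ?_) (i.trans (by linear_combination (-2) * h))
    filter_upwards [hd.memLp.coeFn_toLp, α.bdry_mul_conj] with t ht ht'
    rw [ht]
    simp only [map_sub]
    linear_combination ht' + h
  rw [inner_self_eq_zero] at h1
  have h2 : (fun t => α.bdry t - α.toFun 0) =ᵐ[μ₀] 0 :=
    hd.memLp.coeFn_toLp.symm.trans ((Lp.eq_zero_iff_ae_eq_zero).1 h1)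
  refine hα ⟨α.toFun 0, fun z => ?_⟩
  rw [← α.integral_bdry_mul_cauchyKernel z, ← mul_one (α.toFun 0), ← integral_cauchyKernel z,
    ← integral_const_mul]
  refine integral_congr_ae ?_
  filter_upwards [h2] with t ht
  rw [sub_eq_zero.1 ht]

theorem integral_kernelFun (w : 𝔻) :
    ∫ t, α.kernelFun w t ∂μ₀ = 1 - conj (α.toFun w) * α.toFun 0 := by
  have h1 := (α.isBddHardy_one_sub (conj (α.toFun w))).isHardy.integral_mul
    (isBddHardy_conj_cauchyKernel w).isHardy
  simp only [← kernelFun_eq] at h1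
  have i := ((hasIntegralEq_const 1).add
    (α.hasIntegralEq_bdry.const_mul (-conj (α.toFun w)))).2
  rw [integral_conj, integral_cauchyKernel, map_one, mul_one] at h1
  rw [h1]
  refine Eq.trans (integral_congr_ae (ae_of_all _ fun t => ?_)) (i.trans (by ring))
  simp only
  ring

end InnerFunction

open InnerFunction

variable {α β : InnerFunction}

/-- The factorisation behind the displacement structure of truncated Toeplitz operators. -/
theorem kernelFun_mul_conj_kernelFun (w z : 𝔻) (t : UnitAddCircle) :
    (1 - conj (w : ℂ) * z) * (α.kernelFun w t * conj (β.kernelFun z t)) =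
      α.kernelFun w t * (1 - β.toFun z * conj (β.bdry t)) +
      (1 - conj (α.toFun w) * α.bdry t) * conj (β.kernelFun z t) -
      (1 - conj (α.toFun w) * α.bdry t) * (1 - β.toFun z * conj (β.bdry t)) := by
  have hf : (fourier 1 t : ℂ) * fourier (-1) t = 1 := by
    rw [← fourier_add]
    simp
  have h1 : (1 - (z : ℂ) * fourier (-1) t) * cauchyKernel z t = 1 :=
    mul_inv_cancel₀ (one_sub_mul_fourier_ne_zero z (-1) t)
  have h2 : (1 - conj (w : ℂ) * fourier 1 t) * conj (cauchyKernel w t) = 1 := by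
    have := congrArg conj (mul_inv_cancel₀ (one_sub_mul_fourier_ne_zero w (-1) t))
    simpa only [map_mul, map_sub, map_one, fourier_neg, Complex.conj_conj, cauchyKernel] using this
  -- With `x = 1/(1 - w̄ζ)` and `y = 1/(1 - zζ̄)`, the identities `w̄ζx = x - 1` and `zζ̄y = y - 1`
  -- multiply to `w̄z xy = (x - 1)(y - 1)`, as `ζζ̄ = 1`.
  have h3 : (1 - conj (w : ℂ) * z) * (conj (cauchyKernel w t) * cauchyKernel z t) =
      conj (cauchyKernel w t) + cauchyKernel z t - 1 := by
    set x := conj (cauchyKernel w t)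
    set y := cauchyKernel z t
    have hx : conj (w : ℂ) * fourier 1 t * x = x - 1 := by linear_combination -h2
    have hy : (z : ℂ) * fourier (-1) t * y = y - 1 := by linear_combination -h1
    have hxy : conj (w : ℂ) * z * (x * y) = (x - 1) * (y - 1) := by
      rw [← hx, ← hy]
      linear_combination (-conj (w : ℂ) * z * (x * y)) * hf
    linear_combination -hxy
  simp only [kernelFun_eq, map_mul, map_sub, map_one, Complex.conj_conj]
  linear_combination ((1 - conj (α.toFun w) * α.bdry t) *
    (1 - β.toFun z * conj (β.bdry t))) * h3

/-- The separated form of the equations `⟨(χ̄ + ψ) k_w^α, k_z^β⟩ = 0`. -/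
theorem exists_separated {χ ψ : UnitAddCircle → ℂ} (hχ : α.IsModel χ) (hψ : β.IsModel ψ)
    (h : ∀ w z : 𝔻,
      ∫ t, (conj (χ t) + ψ t) * α.kernelFun w t * conj (β.kernelFun z t) ∂μ₀ = 0) :
    ∃ (B Q : 𝔻 → ℂ) (C : ℂ), ∀ z w : 𝔻,
      ∫ t, ψ t * cauchyKernel z t ∂μ₀ + conj (∫ t, χ t * cauchyKernel w t ∂μ₀) =
        β.toFun z * B w + conj (α.toFun w) * Q z + C := by
  set D : UnitAddCircle → ℂ := fun t => conj (χ t) + ψ t with hD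
  have hDm : MemLp D 2 μ₀ := (memLp_conj hχ.1.1).add hψ.1.1
  have hint : ∀ x : UnitAddCircle → ℂ, MemLp x 2 μ₀ →
      HasIntegralEq (fun t => D t * x t) (∫ t, D t * x t ∂μ₀) :=
    fun x hx => ⟨integrable_mul_of_memLp hDm hx, rfl⟩
  have hk := fun w => (α.isBddHardy_kernelFun w).isHardy.1
  have hk' := fun z => memLp_conj (β.isBddHardy_kernelFun z).isHardy.1
  have hαm := α.isBddHardy_bdry.isHardy.1
  have hβm := memLp_conj β.isBddHardy_bdry.isHardy.1
  have hβb := β.isBddHardy_bdry.norm_conj_le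
  -- The part from `χ̄` is computed by the reproducing property, the part from `ψ` by
  -- multiplicativity of evaluation at the origin.
  have hDk : ∀ w : 𝔻, ∫ t, D t * α.kernelFun w t ∂μ₀ =
      conj (∫ t, χ t * cauchyKernel w t ∂μ₀) +
        (∫ t, ψ t ∂μ₀) * (1 - conj (α.toFun w) * α.toFun 0) := by
    intro w
    rw [← α.integral_kernelFun, ← hψ.1.integral_mul (α.isBddHardy_kernelFun w).isHardy,
      ← hχ.integral_mul_conj_kernelFun, ← integral_conj, ← integral_add]
    · refine integral_congr_ae (ae_of_all _ fun t => ?_)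
      simp only [hD, map_mul, Complex.conj_conj]
      ring
    · exact (HasIntegralEq.conj_eq
        ⟨integrable_mul_of_memLp hχ.1.1 (memLp_conj (hk w)), rfl⟩).1
    · exact integrable_mul_of_memLp hψ.1.1 (hk w)
  have hDk' : ∀ z : 𝔻, ∫ t, D t * conj (β.kernelFun z t) ∂μ₀ =
      ∫ t, ψ t * cauchyKernel z t ∂μ₀ +
        conj ((∫ t, χ t ∂μ₀) * (1 - conj (β.toFun z) * β.toFun 0)) := by
    intro z
    rw [← β.integral_kernelFun, ← hχ.1.integral_mul (β.isBddHardy_kernelFun z).isHardy,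
      ← hψ.integral_mul_conj_kernelFun, ← integral_conj, ← integral_add]
    · refine integral_congr_ae (ae_of_all _ fun t => ?_)
      simp only [hD, map_mul]
      ring
    · exact integrable_mul_of_memLp hψ.1.1 (hk' z)
    · exact (HasIntegralEq.conj_eq ⟨integrable_mul_of_memLp hχ.1.1
        (β.isBddHardy_kernelFun z).isHardy.1, rfl⟩).1
  -- The factorisation of the product of kernels, expanded and integrated against `D`. Each term
  -- except the pairings of `D` with a kernel alone carries a factor `β(z)` or `conj α(w)`, or is
  -- constant.
  have hsum : ∀ w z : 𝔻, 0 =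
      ∫ t, D t * α.kernelFun w t ∂μ₀ +
      -β.toFun z * ∫ t, D t * (conj (β.bdry t) * α.kernelFun w t) ∂μ₀ +
      ∫ t, D t * conj (β.kernelFun z t) ∂μ₀ +
      -conj (α.toFun w) * ∫ t, D t * (α.bdry t * conj (β.kernelFun z t)) ∂μ₀ +
      -1 * ∫ t, D t * 1 ∂μ₀ +
      conj (α.toFun w) * ∫ t, D t * α.bdry t ∂μ₀ +
      β.toFun z * ∫ t, D t * conj (β.bdry t) ∂μ₀ +
      -(conj (α.toFun w) * β.toFun z) * ∫ t, D t * (α.bdry t * conj (β.bdry t)) ∂μ₀ := by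
    intro w z
    have i := (((((((hint _ (hk w)).add
      ((hint _ (memLp_bdd_mul hβm.1 hβb (hk w))).const_mul (-β.toFun z))).add
      (hint _ (hk' z))).add
      ((hint _ (memLp_bdd_mul hαm.1 α.isBddHardy_bdry.bounded (hk' z))).const_mul
        (-conj (α.toFun w)))).add
      ((hint _ (memLp_const 1)).const_mul (-1))).add
      ((hint _ hαm).const_mul (conj (α.toFun w)))).add
      ((hint _ hβm).const_mul (β.toFun z))).add
      ((hint _ (memLp_bdd_mul hαm.1 α.isBddHardy_bdry.bounded hβm)).const_mul
        (-(conj (α.toFun w) * β.toFun z)))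
    rw [← i.2, ← mul_zero (1 - conj (w : ℂ) * z), ← h w z, ← integral_const_mul]
    refine integral_congr_ae (ae_of_all _ fun t => ?_)
    have := kernelFun_mul_conj_kernelFun (α := α) (β := β) w z t
    simp only
    linear_combination D t * this
  refine ⟨fun w => ∫ t, D t * (conj (β.bdry t) * α.kernelFun w t) ∂μ₀ +
      conj (∫ t, χ t ∂μ₀) * conj (β.toFun 0) - ∫ t, D t * conj (β.bdry t) ∂μ₀ +
      conj (α.toFun w) * ∫ t, D t * (α.bdry t * conj (β.bdry t)) ∂μ₀,
    fun z => ∫ t, D t * (α.bdry t * conj (β.kernelFun z t)) ∂μ₀ +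
      (∫ t, ψ t ∂μ₀) * α.toFun 0 - ∫ t, D t * α.bdry t ∂μ₀,
    ∫ t, D t * 1 ∂μ₀ - ∫ t, ψ t ∂μ₀ - conj (∫ t, χ t ∂μ₀), fun z w => ?_⟩
  have h1 := hsum w z
  rw [hDk, hDk'] at h1
  simp only [map_mul, map_sub, map_one, Complex.conj_conj] at h1
  linear_combination -h1

/-- In `k_0^α = 1 - conj (α(0)) α` and `k_0^β` only the constants count: the other terms pair `f`
with `αg` and `g` with `βf`, and vanish. -/
theorem integral_conj_kernelFun_add_mul {f g : UnitAddCircle → ℂ} (hf : α.IsModel f)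
    (hg : β.IsModel g) (a b : ℂ) :
    ∫ t, (conj (a * α.kernelFun 0 t) + b * β.kernelFun 0 t) * f t * conj (g t) ∂μ₀ =
      (conj a + b) * ∫ t, f t * conj (g t) ∂μ₀ := by
  have i0 : HasIntegralEq (fun t => f t * conj (g t)) (∫ t, f t * conj (g t) ∂μ₀) :=
    ⟨integrable_mul_of_memLp hf.1.1 (memLp_conj hg.1.1), rfl⟩
  have i1 : HasIntegralEq (fun t => f t * conj (α.bdry t * g t)) 0 :=
    ⟨integrable_mul_of_memLp hf.1.1 (memLp_conj (α.isBddHardy_bdry.mul_isHardy hg.1).1),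
      hf.2 g hg.1⟩
  have i2 : HasIntegralEq (fun t => g t * conj (β.bdry t * f t)) 0 :=
    ⟨integrable_mul_of_memLp hg.1.1 (memLp_conj (β.isBddHardy_bdry.mul_isHardy hf.1).1),
      hg.2 f hf.1⟩
  have i := ((i0.const_mul (conj a + b)).add (i1.const_mul (-conj a * α.toFun 0))).add
    (i2.conj_eq.const_mul (-b * conj (β.toFun 0)))
  refine Eq.trans (integral_congr_ae (ae_of_all _ fun t => ?_)) (i.2.trans (by simp))
  simp only [kernelFun_zero, map_mul, map_sub, map_one, Complex.conj_conj]
  ring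

/-- If both vanished, the second would give `∫ α β̄ = α(0) conj β(0)`, and then the first would read
`(1 - |α(0)|²)(1 - |β(0)|²) = 0`, impossible for nonconstant inner functions. -/
theorem exists_integral_mul_conj_ne_zero (hα : ¬ α.IsConstant) (hβ : ¬ β.IsConstant) :
    ∫ t, α.kernelFun 0 t * conj (β.kernelFun 0 t) ∂μ₀ ≠ 0 ∨
      ∫ t, α.backwardShift t * conj (β.backwardShift t) ∂μ₀ ≠ 0 := by
  by_contra! h
  obtain ⟨h1, h2⟩ := h
  set c := ∫ t, α.bdry t * conj (β.bdry t) ∂μ₀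
  have i0 : HasIntegralEq (fun t => α.bdry t * conj (β.bdry t)) c :=
    ⟨integrable_mul_of_memLp α.isBddHardy_bdry.isHardy.1
      (memLp_conj β.isBddHardy_bdry.isHardy.1), rfl⟩
  have iα := α.hasIntegralEq_bdry
  have iβ := β.hasIntegralEq_bdry.conj_eq
  have i1 := (((hasIntegralEq_const 1).add (iα.const_mul (-conj (α.toFun 0)))).add
    (iβ.const_mul (-β.toFun 0))).add (i0.const_mul (conj (α.toFun 0) * β.toFun 0))
  have i2 := (((hasIntegralEq_const (α.toFun 0 * conj (β.toFun 0))).add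
    (iα.const_mul (-conj (β.toFun 0)))).add (iβ.const_mul (-α.toFun 0))).add i0
  have e1 := i1.2
  have e2 := i2.2
  rw [integral_congr_ae (g := fun t => α.kernelFun 0 t * conj (β.kernelFun 0 t)), h1] at e1
  rw [integral_congr_ae (g := fun t => α.backwardShift t * conj (β.backwardShift t)), h2] at e2
  have hα' := sub_ne_zero.2 (α.toFun_zero_mul_conj_ne_one hα)
  have hβ' := sub_ne_zero.2 (β.toFun_zero_mul_conj_ne_one hβ)
  · refine mul_ne_zero hα' hβ' ?_
    linear_combination -e1 + conj (α.toFun 0) * β.toFun 0 * e2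
  · refine ae_of_all _ fun t => ?_
    have hf : (fourier 1 t : ℂ) * fourier (-1) t = 1 := by
      rw [← fourier_add]
      simp
    simp only [backwardShift, map_mul, map_sub, fourier_neg, Complex.conj_conj] at hf ⊢
    linear_combination
      (-(α.bdry t - α.toFun 0) * (conj (β.bdry t) - conj (β.toFun 0))) * hf
  · refine ae_of_all _ fun t => ?_
    simp only [kernelFun_zero, map_mul, map_sub, map_one, Complex.conj_conj]
    ring

/-- If the operator with symbol `χ̄ + ψ` vanishes on bounded functions, then `χ` and `ψ` are
multiples of the kernels at the origin. -/
theorem exists_ae_eq_kernelFun (hα : ¬ α.IsConstant) (hβ : ¬ β.IsConstant)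
    {χ ψ : UnitAddCircle → ℂ} (hχ : α.IsModel χ) (hψ : β.IsModel ψ)
    (h : ∀ f g, α.IsModel f → (∃ C : ℝ, ∀ᵐ t ∂μ₀, ‖f t‖ ≤ C) → β.IsModel g →
      ∫ t, (conj (χ t) + ψ t) * f t * conj (g t) ∂μ₀ = 0) :
    ∃ c : ℂ, (χ =ᵐ[μ₀] fun t => -conj c * α.kernelFun 0 t) ∧
      ψ =ᵐ[μ₀] fun t => c * β.kernelFun 0 t := by
  obtain ⟨B, Q, C, hsep⟩ := exists_separated hχ hψ fun w z =>
    h _ _ (α.isModel_kernelFun w) (α.isBddHardy_kernelFun w).bounded (β.isModel_kernelFun z)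
  obtain ⟨w₁, w₂, hw⟩ := α.exists_toFun_ne hα
  obtain ⟨z₁, z₂, hz⟩ := β.exists_toFun_ne hβ
  obtain ⟨b, v, hb⟩ := exists_eq_add_mul hsep (w₁ := w₁) (w₂ := w₂)
    fun h => hw ((starRingEnd ℂ).injective h)
  -- The same elimination with the roles of `z` and `w` exchanged, so it is `conj χ` that comes out
  -- affine in `conj α`.
  obtain ⟨a, u, ha⟩ := exists_eq_add_mul (P := fun w : 𝔻 => conj (∫ t, χ t * cauchyKernel w t ∂μ₀))
    (R := fun z : 𝔻 => ∫ t, ψ t * cauchyKernel z t ∂μ₀) (b := fun w : 𝔻 => conj (α.toFun w))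
    (B := Q) (a := fun z : 𝔻 => β.toFun z) (Q := B) (C := C)
    (fun w z => by rw [add_comm, hsep z w]; ring) hz
  have hψ' := hψ.ae_eq_kernelFun hb
  have hχ' := hχ.ae_eq_kernelFun (u := conj a) (v := conj u) fun z => by
    have := congrArg conj (ha z)
    simpa only [map_add, map_mul, Complex.conj_conj] using this
  have key : ∀ f g, α.IsModel f → IsBddHardy f → β.IsModel g →
      (a + b) * ∫ t, f t * conj (g t) ∂μ₀ = 0 := by
    intro f g hf hfb hg
    have h1 := integral_conj_kernelFun_add_mul hf hg (conj a) b
    rw [Complex.conj_conj] at h1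
    rw [← h1, ← h f g hf hfb.bounded hg]
    refine integral_congr_ae ?_
    filter_upwards [hχ', hψ'] with t h2 h3
    rw [h2, h3]
  -- The symbol is now `a · conj k_0^α + b · k_0^β`, whose form is `(a + b)⟨f, g⟩`.
  have hab : a + b = 0 := by
    rcases exists_integral_mul_conj_ne_zero hα hβ with h1 | h1
    · exact (mul_eq_zero.1 (key _ _ (α.isModel_kernelFun 0) (α.isBddHardy_kernelFun 0)
        (β.isModel_kernelFun 0))).resolve_right h1
    · exact (mul_eq_zero.1 (key _ _ α.isModel_backwardShift
        (.of_isHardy α.isModel_backwardShift.1 α.norm_backwardShift_le)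
        β.isModel_backwardShift)).resolve_right h1
  refine ⟨b, ?_, hψ'⟩
  rwa [← map_neg, ← eq_neg_of_add_eq_zero_left hab]

/-! ### The family of all symbol pairs -/

theorem coeFn_kernel (α : InnerFunction) (w : 𝔻) : α.kernel w =ᵐ[μ₀] α.kernelFun w :=
  (α.memLp_kernelFun w).coeFn_toLp

theorem kernel_mem_K (α : InnerFunction) (w : 𝔻) : α.kernel w ∈ α.K :=
  (α.isModel_kernelFun w).toLp_mem

theorem atto_star_sub_add (χ ψ : L2) (c : ℂ) :
    atto α β (star (χ - conj c • α.kernel 0) + (ψ + c • β.kernel 0)) =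
      atto α β (star χ + ψ) := by
  -- In `-c · conj k_0^α + c · k_0^β` the constants cancel, leaving `c α(0) conj α - c conj (β(0))
  -- β`; hence these constant `p` and `q`.
  refine atto_eq_of_ae_eq_add (isBddHardy_const (conj (c * α.toFun 0))).isHardy
    (isBddHardy_const (-c * conj (β.toFun 0))).isHardy ?_
  filter_upwards [coeFn_kernel α 0, coeFn_kernel β 0,
    Lp.coeFn_add (star (χ - conj c • α.kernel 0)) (ψ + c • β.kernel 0),
    Lp.coeFn_star (χ - conj c • α.kernel 0), Lp.coeFn_sub χ (conj c • α.kernel 0),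
    Lp.coeFn_smul (conj c) (α.kernel 0), Lp.coeFn_add ψ (c • β.kernel 0),
    Lp.coeFn_smul c (β.kernel 0), Lp.coeFn_add (star χ) ψ, Lp.coeFn_star χ]
    with t h1 h2 h3 h4 h5 h6 h7 h8 h9 h10
  rw [h3, h9, Pi.add_apply, Pi.add_apply, h4, h7, h10]
  simp only [Pi.star_apply, Pi.add_apply]
  rw [h5, h8, Pi.sub_apply, h6, Pi.smul_apply, Pi.smul_apply, h1, h2]
  simp only [RCLike.star_def, kernelFun_zero, map_mul, map_sub, map_one, Complex.conj_conj,
    smul_eq_mul]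
  ring

/-- The symbols in `conj K_α + K_β` of a given operator. -/
theorem exists_eq_sub_kernel (hα : ¬ α.IsConstant) (hβ : ¬ β.IsConstant) {χ ψ χ₁ ψ₁ : L2}
    (hχ : χ ∈ α.K) (hψ : ψ ∈ β.K) (hχ₁ : χ₁ ∈ α.K) (hψ₁ : ψ₁ ∈ β.K)
    (h : atto α β (star χ₁ + ψ₁) = atto α β (star χ + ψ)) :
    ∃ c : ℂ, χ₁ = χ - conj c • α.kernel 0 ∧ ψ₁ = ψ + c • β.kernel 0 := by
  have hsub : (fun t => (star χ₁ + ψ₁ : L2) t - (star χ + ψ : L2) t) =ᵐ[μ₀]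
      fun t => conj ((χ₁ - χ : L2) t) + (ψ₁ - ψ : L2) t := by
    filter_upwards [Lp.coeFn_add (star χ₁) ψ₁, Lp.coeFn_add (star χ) ψ, Lp.coeFn_star χ₁,
      Lp.coeFn_star χ, Lp.coeFn_sub χ₁ χ, Lp.coeFn_sub ψ₁ ψ] with t h1 h2 h3 h4 h5 h6
    rw [h1, h2, h5, h6, Pi.add_apply, Pi.add_apply, h3, h4]
    simp only [Pi.star_apply, Pi.sub_apply, RCLike.star_def, map_sub]
    ring
  obtain ⟨c, h1, h2⟩ := exists_ae_eq_kernelFun hα hβ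
    ((α.mem_K_iff _).1 (α.K.sub_mem hχ₁ hχ)) ((β.mem_K_iff _).1 (β.K.sub_mem hψ₁ hψ))
    fun f g hf hfb hg => by
      rw [← integral_sub_mul_eq_zero_of_atto_eq h hf hfb hg]
      refine integral_congr_ae ?_
      filter_upwards [hsub] with t ht
      rw [ht]
  have e1 : χ₁ - χ = (-conj c) • α.kernel 0 := by
    refine Lp.ext ?_
    filter_upwards [h1, Lp.coeFn_smul (-conj c) (α.kernel 0), coeFn_kernel α 0] with t a1 a2 a3
    rw [a1, a2, Pi.smul_apply, a3, smul_eq_mul]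
  have e2 : ψ₁ - ψ = c • β.kernel 0 := by
    refine Lp.ext ?_
    filter_upwards [h2, Lp.coeFn_smul c (β.kernel 0), coeFn_kernel β 0] with t a1 a2 a3
    rw [a1, a2, Pi.smul_apply, a3, smul_eq_mul]
  refine ⟨c, ?_, ?_⟩
  · rw [sub_eq_iff_eq_add.1 e1, neg_smul, neg_add_eq_sub]
  · rw [sub_eq_iff_eq_add.1 e2, add_comm]

end ModelSpaces

end

open ModelSpaces in
theorem mainTheorem2 (α β : InnerFunction) (hα : ¬ α.IsConstant) (hβ : ¬ β.IsConstant) (φ : L2) :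
    (∃ χ ∈ α.K, ∃ ψ ∈ β.K, atto α β φ = atto α β (star χ + ψ)) ∧
    ∀ χ ∈ α.K, ∀ ψ ∈ β.K, atto α β φ = atto α β (star χ + ψ) →
      ∀ χ₁ ψ₁ : L2,
        (χ₁ ∈ α.K ∧ ψ₁ ∈ β.K ∧ atto α β φ = atto α β (star χ₁ + ψ₁)) ↔
          ∃ c : ℂ, χ₁ = χ - conj c • α.kernel 0 ∧ ψ₁ = ψ + c • β.kernel 0 := by
  refine ⟨exists_atto_eq α β φ, fun χ hχ ψ hψ h χ₁ ψ₁ => ⟨?_, ?_⟩⟩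
  · rintro ⟨hχ₁, hψ₁, h₁⟩
    exact exists_eq_sub_kernel hα hβ hχ hψ hχ₁ hψ₁ (h₁.symm.trans h)
  · rintro ⟨c, rfl, rfl⟩
    exact ⟨α.K.sub_mem hχ (α.K.smul_mem _ (kernel_mem_K α 0)),
      β.K.add_mem hψ (β.K.smul_mem _ (kernel_mem_K β 0)),
      h.trans (atto_star_sub_add χ ψ c).symm⟩
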